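/- Let $B_1,\dots,B_m$ be real orthogonal $n\times n$ matrices with $B_j^{-1}B_l=-B_l^{-1}B_j$ for $j\ne l$, let $k\in\mathbb R^m\setminus\{0\}$ (for example $k\in\mathbb Z^m\setminus\{0\}$), let $\|k\|$ be its Euclidean norm, and put $B_k=\sum_j k_jB_j$. For $q,p\in\mathbb R^n$ let $(\pi_k(q,p)u)(x)=e^{iq\cdot B_k(x+p/2)}u(x+p)$, and let $\varphi(x)=2^{n/4}e^{-|x|^2/2}$ on $\mathbb R^n$. For a symbol $F$ on $\mathbb R^{2n}$, the localization operator $L^k_{F,\varphi}$ is the bounded operator on $L^2(\mathbb R^n)$ (if there is one) such that, for all $f,g\in L^2(\mathbb R^n)$, $$\langle L^k_{F,\varphi}f,g\rangle=(2\pi)^{-n}\|k\|^n\int_{\mathbb R^{2n}}F(q,p)\,\langle f,\pi_k(q,p)\varphi\rangle\,\langle\pi_k(q,p)\varphi,g\rangle\,dq\,dp,$$ where the integral converges absolutely. Let $F^k(q,p)=F\big(B_kp/\|k\|^2,-B_k^tq/\|k\|^2\big)$ and let $\widehat{u}(\zeta)=(2\pi)^{-n}\int_{\mathbb R^{2n}}e^{-i\zeta\cdot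 z}u(z)\,dz$ be the Fourier transform, extended to $L^2(\mathbb R^{2n})$. For $c\ge 0$ let $W_c^k$ be the set of all $F\in L^2(\mathbb R^{2n})$ for which there is $f\in L^2(\mathbb R^{2n})$ with $$\big|\widehat{F^k}(\xi,\eta)\big|\le e^{-c(|B_k\xi|^2+|\eta|^2)}\,|f(\xi,\eta)|\quad\text{for almost all }(\xi,\eta)\in\mathbb R^{2n}.$$ Theorem. Let $c>\frac{1+\sqrt5}{8}$ and $F,G\in W_c^k$. Then the localization operators $L^k_{F,\varphi}$ and $L^k_{G,\varphi}$ exist, and there is a function $H$ on $\mathbb R^{2n}$ such that $$L^k_{F,\varphi}L^k_{G,\varphi}=L^k_{H,\varphi}$$ and such that, for every $\varepsilon$ with $\frac{4c}{8c+1}<\varepsilon<1-\frac1{4c}$, one has $H\in W_d^k$ for all $0<d\le c_\varepsilon$, where $c_\varepsilon=c-c\varepsilon-\frac14$. -/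

import Mathlib

open MeasureTheory FourierTransform

noncomputable section

namespace HeisLoc

/-- `ℝⁿ` with its Euclidean norm. -/
abbrev Rn (n : ℕ) : Type := EuclideanSpace ℝ (Fin n)

/-- `ℝ²ⁿ = ℝⁿ × ℝⁿ` with its Euclidean norm and Lebesgue measure; points are pairs `(q, p)`. -/
abbrev R2n (n : ℕ) : Type := WithLp 2 (Rn n × Rn n)

/-- The structure matrices of a nonisotropic Heisenberg group with `m`-dimensional center:
orthogonal `n × n` matrices with `Bⱼ⁻¹ Bₗ = - Bₗ⁻¹ Bⱼ` for `j ≠ l`. -/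
structure IsStructureFamily {n m : ℕ} (B : Fin m → Matrix (Fin n) (Fin n) ℝ) : Prop where
  orthogonal : ∀ j, B j ∈ Matrix.orthogonalGroup (Fin n) ℝ
  anticomm : ∀ j l, j ≠ l → (B j)⁻¹ * B l = -((B l)⁻¹ * B j)

/-- The matrix `B_k = k₁ B₁ + ⋯ + kₘ Bₘ`. -/
def matB {n m : ℕ} (B : Fin m → Matrix (Fin n) (Fin n) ℝ) (k : EuclideanSpace ℝ (Fin m)) :
    Matrix (Fin n) (Fin n) ℝ :=
  ∑ j, k j • B j

/-- The action `x ↦ M x` of a matrix on `ℝⁿ`. -/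
def act {n : ℕ} (M : Matrix (Fin n) (Fin n) ℝ) (x : Rn n) : Rn n :=
  Matrix.toEuclideanLin M x

/-- The Schrödinger representation
`(π_k(q,p) u)(x) = exp (i q · B_k (x + p/2)) u (x + p)`. -/
def schrodinger {n m : ℕ} (B : Fin m → Matrix (Fin n) (Fin n) ℝ) (k : EuclideanSpace ℝ (Fin m))
    (z : R2n n) (u : Rn n → ℂ) (x : Rn n) : ℂ :=
  Complex.exp (Complex.I *
    ((inner ℝ z.fst (act (matB B k) (x + (1 / 2 : ℝ) • z.snd)) : ℝ) : ℂ)) * u (x + z.snd)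

/-- The `L²(ℝⁿ)` pairing `⟨u, v⟩ = ∫ u v̄`, linear in the first argument. -/
def pairing {n : ℕ} (u v : Rn n → ℂ) : ℂ :=
  ∫ x, u x * (starRingEnd ℂ) (v x)

/-- The Gaussian wavelet `φ(x) = 2^{n/4} exp (-|x|²/2)`. -/
def gaussianWavelet (n : ℕ) (x : Rn n) : ℂ :=
  (((2 : ℝ) ^ ((n : ℝ) / 4) * Real.exp (-‖x‖ ^ 2 / 2) : ℝ) : ℂ)

/-- The bounded operator `T` on `L²(ℝⁿ)` is the localization operator `L^k_{F,φ}`: for all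
`f, g ∈ L²(ℝⁿ)` the integral below converges absolutely and
`⟨T f, g⟩ = (2π)⁻ⁿ ‖k‖ⁿ ∫ F(q,p) ⟨f, π_k(q,p) φ⟩ ⟨π_k(q,p) φ, g⟩ dq dp`.
There is at most one such `T`. -/
def IsLocalizationOperator {n m : ℕ} (B : Fin m → Matrix (Fin n) (Fin n) ℝ)
    (k : EuclideanSpace ℝ (Fin m)) (φ : Rn n → ℂ) (F : R2n n → ℂ)
    (T : Lp ℂ 2 (volume : Measure (Rn n)) →L[ℂ] Lp ℂ 2 (volume : Measure (Rn n))) : Prop :=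
  ∀ f g : Lp ℂ 2 (volume : Measure (Rn n)),
    Integrable (fun z : R2n n =>
      F z * pairing f (schrodinger B k z φ) * pairing (schrodinger B k z φ) g) ∧
    pairing (T f) g =
      (((2 * Real.pi) ^ n)⁻¹ * ‖k‖ ^ n : ℝ) *
        ∫ z : R2n n, F z * pairing f (schrodinger B k z φ) * pairing (schrodinger B k z φ) g

/-- The function `F^k(q,p) = F (B_k p / ‖k‖², - B_kᵗ q / ‖k‖²)`. -/
def twist {n m : ℕ} (B : Fin m → Matrix (Fin n) (Fin n) ℝ) (k : EuclideanSpace ℝ (Fin m))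
    (F : R2n n → ℂ) (z : R2n n) : ℂ :=
  F (WithLp.toLp 2
    (act (matB B k) ((‖k‖ ^ 2)⁻¹ • z.snd), -act (matB B k).transpose ((‖k‖ ^ 2)⁻¹ • z.fst)))

/-- The Fourier transform on `L²(ℝ²ⁿ)` in the normalization
`û(ζ) = (2π)⁻ⁿ ∫ exp (-i ζ · z) u(z) dz` (for `u ∈ L¹ ∩ L²`). Mathlib's `𝓕` has the kernel
`exp (-2πi ζ · z)`, so that `û(ζ) = (2π)⁻ⁿ (𝓕 u)(ζ / 2π)`. -/
def hat {n : ℕ} (u : Lp ℂ 2 (volume : Measure (R2n n))) (ζ : R2n n) : ℂ :=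
  (((2 * Real.pi) ^ n)⁻¹ : ℝ) *
    (𝓕 u : Lp ℂ 2 (volume : Measure (R2n n))) ((2 * Real.pi)⁻¹ • ζ)

/-- The class `W_c^k`: those `F ∈ L²(ℝ²ⁿ)` for which there is `f ∈ L²(ℝ²ⁿ)` with
`|(F^k)^(ξ,η)| ≤ exp (-c |(B_k ξ, η)|²) |f(ξ,η)|`, where `|(B_k ξ, η)|² = |B_k ξ|² + |η|²`.
(For `k ≠ 0`, `F^k` is in `L²` exactly if `F` is.) -/
def ClassW {n m : ℕ} (B : Fin m → Matrix (Fin n) (Fin n) ℝ) (k : EuclideanSpace ℝ (Fin m))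
    (c : ℝ) (F : R2n n → ℂ) : Prop :=
  MemLp F 2 volume ∧
    ∃ hF : MemLp (twist B k F) 2 volume, ∃ f : R2n n → ℂ, MemLp f 2 volume ∧
      ∀ᵐ ζ : R2n n ∂volume,
        ‖hat (hF.toLp (twist B k F)) ζ‖ ≤
          Real.exp (-c * (‖act (matB B k) ζ.fst‖ ^ 2 + ‖ζ.snd‖ ^ 2)) * ‖f ζ‖

end HeisLoc

end

/-! The relations on the `B j` make `B_k` equal to `‖k‖` times an orthogonal map `U`, so with `r =
‖k‖` the problem concerns one Schrödinger representation `weyl r U`, written π below. Write Q for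
the form `quad r`.

A localization operator is a superposition ∫ a(ζ) π(ζ) dζ. By the orthogonality relations, the
symplectic Fourier transform of ⟨f, π(z)φ⟩⟨π(z)φ, g⟩ is a constant times exp(-Q(ζ)/4) ⟨π(ζ)f, g⟩
(`integral_exp_mul_wavelet`). Parseval then gives a = κ exp(-Q/4) (F^k)^ with κ = (2π)^(-n/2)
(`integral_mul_wavelet`). For F in W_c^k this is κ exp(-δQ) f₀ with δ = c + 1/4 and f₀ in L². It is
integrable, so the operator exists and is bounded (`exists_isSuperposition`).

Composition becomes twisted convolution of coefficients (`IsSuperposition.comp`). The parallelogram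
law Q(u-v) + Q(v) = Q(u)/2 + 2Q(v - u/2) extracts exp(-δQ(u)/2) and leaves a Gaussian in v. By
Cauchy–Schwarz what remains is in L² (`twistedConv_gaussian`, `memLp_dampedConv`). Dividing by
exp(-Q/4) gives the transform of H^k, with decay rate δ/2 - 1/4 = c/2 - 1/8. For c > 1/4 this rate
is positive, so the transform is in L² and H exists. Each rate c - cε - 1/4 in the theorem is at
most c/2 - 1/8. -/

noncomputable section

namespace HeisLoc

open scoped SchwartzMap ComplexConjugate ENNReal

/-! ### The Fourier transform on L¹ ∩ L², and Parseval. -/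

section Plancherel

variable {E : Type*} [NormedAddCommGroup E] [InnerProductSpace ℝ E] [FiniteDimensional ℝ E]
  [MeasurableSpace E] [BorelSpace E]

/-- Self-adjointness of the Fourier transform: `∫ 𝓕 s * u = ∫ s * 𝓕 u`. -/
theorem integral_fourier_smul_eq {s u : E → ℂ} (hs : Integrable s) (hu : Integrable u) :
    ∫ x, 𝓕 s x • u x = ∫ x, s x • 𝓕 u x := by
  have := VectorFourier.integral_fourierIntegral_smul_eq_flip (L := innerₗ E) (μ := volume)
    (ν := volume) Real.continuous_fourierChar continuous_inner hs hu
  rw [flip_innerₗ] at this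
  exact this

theorem continuous_fourier_of_integrable {u : E → ℂ} (hu : Integrable u) : Continuous (𝓕 u) :=
  VectorFourier.fourierIntegral_continuous Real.continuous_fourierChar
    (L := innerₗ E) continuous_inner hu

/-- On `L¹ ∩ L²`, the Fourier transform on `L²` is given by the Fourier integral. -/
theorem fourier_toLp_ae_eq {u : E → ℂ} (h1 : Integrable u) (h2 : MemLp u 2) :
    (𝓕 (h2.toLp u) : Lp ℂ 2 (volume : Measure E)) =ᵐ[volume] 𝓕 u := by
  have key : ∀ s : 𝓢(E, ℂ),
      ∫ x, s x • (𝓕 (h2.toLp u) : Lp ℂ 2 (volume : Measure E)) x = ∫ x, s x • 𝓕 u x := by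
    intro s
    have h := congrArg (fun T : 𝓢'(E, ℂ) => T s) (Lp.fourier_toTemperedDistribution_eq (h2.toLp u))
    simp only [TemperedDistribution.fourier_apply, Lp.toTemperedDistribution_apply] at h
    rw [← h, ← integral_fourier_smul_eq s.integrable h1, SchwartzMap.fourier_coe]
    refine integral_congr_ae ?_
    filter_upwards [h2.coeFn_toLp] with x hx
    rw [hx]
  -- Both sides are locally integrable, so testing against compactly supported smooth functions,
  -- which are Schwartz, is enough.
  refine ae_eq_of_integral_contDiff_smul_eq
    ((Lp.memLp _).locallyIntegrable (by norm_num))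
    (continuous_fourier_of_integrable h1).locallyIntegrable fun g hg hg' => ?_
  have hc : HasCompactSupport (fun x => (g x : ℂ)) := hg'.comp_left (g := Complex.ofReal) (by simp)
  have := key (hc.toSchwartzMap (Complex.ofRealCLM.contDiff.comp hg))
  simp only [Complex.real_smul]
  exact this

theorem memLp_fourier {u : E → ℂ} (h1 : Integrable u) (h2 : MemLp u 2) : MemLp (𝓕 u) 2 :=
  (memLp_congr_ae (fourier_toLp_ae_eq h1 h2)).1 (Lp.memLp _)

theorem integral_mul_conj_eq_inner {u v : E → ℂ} (hu : MemLp u 2) (hv : MemLp v 2) :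
    ∫ x, u x * conj (v x) = inner ℂ (hv.toLp v) (hu.toLp u) := by
  rw [L2.inner_def]
  refine integral_congr_ae ?_
  filter_upwards [hu.coeFn_toLp, hv.coeFn_toLp] with x h1 h2
  simp [h1, h2]

/-- Parseval's identity for `F ∈ L²` and `v ∈ L¹ ∩ L²`. -/
theorem integral_mul_conj_eq_fourier {F v : E → ℂ} (hF : MemLp F 2) (h1 : Integrable v)
    (h2 : MemLp v 2) :
    ∫ x, F x * conj (v x) =
      ∫ x, (𝓕 (hF.toLp F) : Lp ℂ 2 (volume : Measure E)) x * conj (𝓕 v x) := by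
  rw [integral_mul_conj_eq_inner hF h2, ← Lp.inner_fourier_eq, L2.inner_def]
  refine integral_congr_ae ?_
  filter_upwards [fourier_toLp_ae_eq h1 h2] with x hx
  simp [hx]

theorem integral_fourier_mul_conj {u v : E → ℂ} (hu1 : Integrable u) (hu2 : MemLp u 2)
    (hv1 : Integrable v) (hv2 : MemLp v 2) :
    ∫ x, 𝓕 u x * conj (𝓕 v x) = ∫ x, u x * conj (v x) := by
  rw [integral_mul_conj_eq_fourier hu2 hv1 hv2]
  refine integral_congr_ae ?_
  filter_upwards [fourier_toLp_ae_eq hu1 hu2] with x hx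
  simp [hx]

theorem integral_norm_sq_fourier {u : E → ℂ} (h1 : Integrable u) (h2 : MemLp u 2) :
    ∫ x, ‖𝓕 u x‖ ^ 2 = ∫ x, ‖u x‖ ^ 2 := by
  have := integral_fourier_mul_conj h1 h2 h1 h2
  simp only [Complex.mul_conj, Complex.normSq_eq_norm_sq, integral_complex_ofReal] at this
  exact_mod_cast this

end Plancherel

/-! ### `B_k` as a multiple of an orthogonal map. -/

section Matrices

variable {n m : ℕ}

/-- For orthogonal matrices the hypothesis says that `(B j)ᵀ * B l` is antisymmetric under exchange
of j ≠ l. The cross terms of the expanded square therefore cancel in pairs, and each diagonal term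
contributes `k j ^ 2`. -/
theorem IsStructureFamily.transpose_mul_self {B : Fin m → Matrix (Fin n) (Fin n) ℝ}
    (hB : IsStructureFamily B) (k : EuclideanSpace ℝ (Fin m)) :
    (matB B k).transpose * matB B k = (‖k‖ ^ 2) • (1 : Matrix (Fin n) (Fin n) ℝ) := by
  have hinv : ∀ j, (B j)⁻¹ = (B j).transpose := fun j =>
    Matrix.inv_eq_left_inv ((Matrix.mem_orthogonalGroup_iff' (Fin n) ℝ).1 (hB.orthogonal j))
  have hself : ∀ j, (B j).transpose * B j = 1 := fun j =>
    (Matrix.mem_orthogonalGroup_iff' (Fin n) ℝ).1 (hB.orthogonal j)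
  have hanti : ∀ j l, (B j).transpose * B l + (B l).transpose * B j =
      if j = l then (2 : ℝ) • (1 : Matrix (Fin n) (Fin n) ℝ) else 0 := by
    intro j l
    split_ifs with h
    · subst h
      rw [hself, two_smul]
    · rw [← hinv, ← hinv, hB.anticomm j l h, neg_add_cancel]
  have hS : (matB B k).transpose * matB B k =
      ∑ j, ∑ l, (k j * k l) • ((B l).transpose * B j) := by
    simp only [matB, Matrix.transpose_sum, Matrix.transpose_smul, Finset.sum_mul, Finset.mul_sum,
      Matrix.smul_mul, Matrix.mul_smul, smul_smul]
  have hS' : (matB B k).transpose * matB B k =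
      ∑ j, ∑ l, (k j * k l) • ((B j).transpose * B l) := by
    rw [hS, Finset.sum_comm]
    exact Finset.sum_congr rfl fun x _ => Finset.sum_congr rfl fun y _ => by rw [mul_comm (k y)]
  -- Doubling allows the double sum to be added to its transposed copy, which produces the
  -- anticommutators of `hanti`.
  have h2 : (2 : ℝ) • ((matB B k).transpose * matB B k) =
      (2 : ℝ) • ((‖k‖ ^ 2) • (1 : Matrix (Fin n) (Fin n) ℝ)) := by
    rw [two_smul]
    nth_rw 1 [hS']
    rw [hS, ← Finset.sum_add_distrib]
    simp only [← Finset.sum_add_distrib, ← smul_add, hanti, smul_ite, smul_zero,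
      Finset.sum_ite_eq, Finset.mem_univ, if_true, EuclideanSpace.real_norm_sq_eq,
      Finset.sum_smul, Finset.smul_sum, smul_smul]
    refine Finset.sum_congr rfl fun j _ => ?_
    congr 1
    ring
  exact smul_right_injective _ (two_ne_zero' ℝ) h2

theorem inner_act (M : Matrix (Fin n) (Fin n) ℝ) (x y : Rn n) :
    inner ℝ (act M x) y = inner ℝ x (act M.transpose y) := by
  have := LinearMap.adjoint_inner_right (Matrix.toEuclideanLin M) x y
  rw [← Matrix.toEuclideanLin_conjTranspose_eq_adjoint, Matrix.conjTranspose_eq_transpose_of_trivial]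
    at this
  exact this.symm

/-- `B_k` is `‖k‖` times an orthogonal map. -/
theorem IsStructureFamily.exists_isometry {B : Fin m → Matrix (Fin n) (Fin n) ℝ}
    (hB : IsStructureFamily B) {k : EuclideanSpace ℝ (Fin m)} (hk : k ≠ 0) :
    ∃ U : Rn n ≃ₗᵢ[ℝ] Rn n, (∀ x, act (matB B k) x = ‖k‖ • U x) ∧
      ∀ x, act (matB B k).transpose x = ‖k‖ • U.symm x := by
  have hk' : ‖k‖ ≠ 0 := norm_ne_zero_iff.2 hk
  have hnorm : ∀ x, ‖act (matB B k) x‖ = ‖k‖ * ‖x‖ := by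
    intro x
    have h1 : ‖act (matB B k) x‖ ^ 2 = (‖k‖ * ‖x‖) ^ 2 := by
      rw [← real_inner_self_eq_norm_sq, inner_act]
      have : act (matB B k).transpose (act (matB B k) x) = (‖k‖ ^ 2) • x := by
        simp only [act, Matrix.toLpLin_apply, Matrix.mulVec_mulVec,
          hB.transpose_mul_self]
        ext i
        simp [Matrix.smul_mulVec]
      rw [this, inner_smul_right, real_inner_self_eq_norm_sq, mul_pow]
    exact (pow_left_inj₀ (norm_nonneg _) (by positivity) two_ne_zero).1 h1
  let L : Rn n →ₗᵢ[ℝ] Rn n :=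
    { toLinearMap := ‖k‖⁻¹ • Matrix.toEuclideanLin (matB B k)
      norm_map' := fun x => by
        have := hnorm x
        simp only [act] at this
        rw [LinearMap.smul_apply, norm_smul, this, norm_inv, norm_norm, inv_mul_cancel_left₀ hk'] }
  have hU : ∀ x, act (matB B k) x = ‖k‖ • L.toLinearIsometryEquiv rfl x := by
    intro x
    change act (matB B k) x = ‖k‖ • (‖k‖⁻¹ • act (matB B k) x)
    rw [smul_inv_smul₀ hk']
  refine ⟨L.toLinearIsometryEquiv rfl, hU, fun x => ext_inner_left ℝ fun y => ?_⟩
  rw [← inner_act, hU, inner_smul_left, inner_smul_right, LinearIsometryEquiv.inner_map_eq_flip]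
  simp

end Matrices

/-! ### The representation π, its cocycle, unitarity and measurability. -/

section Weyl

variable {n : ℕ} (r : ℝ) (U : Rn n ≃ₗᵢ[ℝ] Rn n)

/-- The Schrödinger representation for `B_k = r U`, with `U` orthogonal. -/
def weyl (z : R2n n) (u : Rn n → ℂ) (x : Rn n) : ℂ :=
  Complex.exp (Complex.I * ((r * inner ℝ z.fst (U (x + (1 / 2 : ℝ) • z.snd)) : ℝ) : ℂ)) *
    u (x + z.snd)

/-- The phase in `π(z) π(w) = exp (i θ(z, w)) π(z + w)`. -/
def phase (z w : R2n n) : ℝ :=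
  r / 2 * (inner ℝ w.fst (U z.snd) - inner ℝ z.fst (U w.snd))

theorem R2n_ext {z w : R2n n} (h1 : z.fst = w.fst) (h2 : z.snd = w.snd) : z = w :=
  WithLp.ofLp_injective 2 (Prod.ext h1 h2)

/-- The rotation `(q, p) ↦ (U p, -Uᵗ q)` of phase space. -/
def rotation : R2n n ≃ₗᵢ[ℝ] R2n n where
  toFun z := WithLp.toLp 2 (U z.snd, -U.symm z.fst)
  invFun z := WithLp.toLp 2 (-U z.snd, U.symm z.fst)
  map_add' z w := by apply R2n_ext <;> simp [add_comm]
  map_smul' c z := by apply R2n_ext <;> simp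
  left_inv z := by apply R2n_ext <;> simp
  right_inv z := by apply R2n_ext <;> simp
  norm_map' z := by
    refine (pow_left_inj₀ (norm_nonneg _) (norm_nonneg _) two_ne_zero).1 ?_
    simp [WithLp.prod_norm_sq_eq_of_L2, add_comm]

theorem rotation_apply (z : R2n n) : rotation U z = WithLp.toLp 2 (U z.snd, -U.symm z.fst) := rfl

theorem rotation_symm_apply (z : R2n n) :
    (rotation U).symm z = WithLp.toLp 2 (-U z.snd, U.symm z.fst) := rfl

variable {r U}

theorem phase_neg_left (z w : R2n n) : phase r U (-z) w = -phase r U z w := by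
  simp only [phase, WithLp.neg_fst, WithLp.neg_snd, map_neg, inner_neg_left, inner_neg_right]
  ring

theorem phase_antisymm (z w : R2n n) : phase r U w z = -phase r U z w := by
  simp only [phase]
  ring

theorem phase_self (z : R2n n) : phase r U z z = 0 := by simp [phase]

/-- The midpoint `p / 2` in the exponent makes the cocycle antisymmetric; hence π(-z) inverts π(z)
without a phase. -/
theorem weyl_weyl (z w : R2n n) (u : Rn n → ℂ) :
    weyl r U z (weyl r U w u) =
      fun x => Complex.exp (Complex.I * (phase r U z w : ℂ)) * weyl r U (z + w) u x := by
  ext x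
  simp only [weyl, WithLp.add_fst, WithLp.add_snd]
  rw [← mul_assoc, ← mul_assoc, ← Complex.exp_add, ← Complex.exp_add, ← add_assoc]
  congr 2
  rw [← mul_add, ← mul_add, ← Complex.ofReal_add, ← Complex.ofReal_add]
  congr 2
  simp only [phase, map_add, map_smul, inner_add_left, inner_add_right, inner_smul_right]
  ring

theorem weyl_zero (u : Rn n → ℂ) : weyl r U 0 u = u := by
  ext x
  simp [weyl]

theorem norm_weyl (z : R2n n) (u : Rn n → ℂ) (x : Rn n) : ‖weyl r U z u x‖ = ‖u (x + z.snd)‖ := by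
  rw [weyl, norm_mul, mul_comm Complex.I, Complex.norm_exp_ofReal_mul_I, one_mul]

theorem pairing_weyl (z : R2n n) (f g : Rn n → ℂ) :
    pairing (weyl r U z f) g = pairing f (weyl r U (-z) g) := by
  rw [pairing, pairing, ← integral_sub_right_eq_self _ z.snd]
  congr 1 with x
  simp only [weyl, WithLp.neg_fst, WithLp.neg_snd, map_mul, sub_add_cancel, ← sub_eq_add_neg]
  rw [← Complex.exp_conj, map_mul, Complex.conj_I, Complex.conj_ofReal, neg_mul, ← mul_neg,
    ← Complex.ofReal_neg, mul_assoc, mul_left_comm]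
  congr 5
  simp only [map_add, map_sub, map_smul, map_neg, inner_neg_left, inner_add_right, inner_sub_right,
    inner_smul_right, inner_neg_right]
  ring

theorem pairing_conj (f g : Rn n → ℂ) : conj (pairing f g) = pairing g f := by
  rw [pairing, pairing, ← integral_conj]
  congr 1 with x
  simp [mul_comm]

theorem pairing_const_mul_left (c : ℂ) (f g : Rn n → ℂ) :
    pairing (fun x => c * f x) g = c * pairing f g := by
  simp only [pairing, mul_assoc, integral_const_mul]

theorem pairing_const_mul_right (c : ℂ) (f g : Rn n → ℂ) :
    pairing f (fun x => c * g x) = conj c * pairing f g := by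
  rw [← pairing_conj, pairing_const_mul_left, map_mul, pairing_conj]

theorem pairing_congr_ae {f f' g g' : Rn n → ℂ} (hf : f =ᵐ[volume] f') (hg : g =ᵐ[volume] g') :
    pairing f g = pairing f' g' := by
  refine integral_congr_ae ?_
  filter_upwards [hf, hg] with x h1 h2
  rw [h1, h2]

theorem measurable_weyl {u : Rn n → ℂ} (hu : Measurable u) :
    Measurable fun y : R2n n × Rn n => weyl r U y.1 u y.2 := by
  have h1 : Continuous fun y : R2n n × Rn n => y.2 + y.1.snd := by fun_prop
  have h2 : Continuous fun y : R2n n × Rn n =>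
      Complex.exp (Complex.I * ((r * inner ℝ y.1.fst (U (y.2 + (1 / 2 : ℝ) • y.1.snd)) : ℝ) : ℂ)) := by
    have := U.continuous
    fun_prop
  exact h2.measurable.mul (hu.comp h1.measurable)

theorem measurable_weyl_right {u : Rn n → ℂ} (hu : Measurable u) (z : R2n n) :
    Measurable (weyl r U z u) := by
  have h2 : Continuous fun x : Rn n =>
      Complex.exp (Complex.I * ((r * inner ℝ z.fst (U (x + (1 / 2 : ℝ) • z.snd)) : ℝ) : ℂ)) := by
    have := U.continuous
    fun_prop
  exact h2.measurable.mul (hu.comp (measurable_add_const _))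

theorem continuous_phase : Continuous fun y : R2n n × R2n n => phase r U y.1 y.2 := by
  have := U.continuous
  unfold phase
  fun_prop

theorem memLp_weyl {u : Rn n → ℂ} (hu : Measurable u) {p : ℝ≥0∞} (h : MemLp u p) (z : R2n n) :
    MemLp (weyl r U z u) p :=
  (h.comp_measurePreserving (measurePreserving_add_right volume z.snd)).congr_norm
    (measurable_weyl_right hu z).aestronglyMeasurable
    (Filter.Eventually.of_forall fun x => (norm_weyl z u x).symm)

theorem eLpNorm_weyl {u : Rn n → ℂ} (hu : Measurable u) (p : ℝ≥0∞) (z : R2n n) :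
    eLpNorm (weyl r U z u) p volume = eLpNorm u p volume := by
  rw [← eLpNorm_comp_measurePreserving hu.aestronglyMeasurable
    (measurePreserving_add_right volume z.snd)]
  exact eLpNorm_congr_norm_ae (Filter.Eventually.of_forall fun x => norm_weyl z u x)

theorem pairing_eq_inner {f g : Rn n → ℂ} (hf : MemLp f 2) (hg : MemLp g 2) :
    pairing f g = inner ℂ (hg.toLp g) (hf.toLp f) := integral_mul_conj_eq_inner hf hg

theorem norm_pairing_le {f g : Rn n → ℂ} (hf : MemLp f 2) (hg : MemLp g 2) :
    ‖pairing f g‖ ≤ (eLpNorm f 2 volume).toReal * (eLpNorm g 2 volume).toReal := by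
  rw [pairing_eq_inner hf hg, mul_comm, ← Lp.norm_toLp f hf, ← Lp.norm_toLp g hg]
  exact norm_inner_le_norm _ _

theorem norm_pairing_weyl_le {f g : Rn n → ℂ} (hfm : Measurable f) (hf : MemLp f 2)
    (hg : MemLp g 2) (z : R2n n) :
    ‖pairing (weyl r U z f) g‖ ≤
      (eLpNorm f 2 volume).toReal * (eLpNorm g 2 volume).toReal := by
  rw [← eLpNorm_weyl (r := r) (U := U) hfm 2 z]
  exact norm_pairing_le (memLp_weyl hfm hf z) hg

theorem measurable_pairing_weyl {f g : Rn n → ℂ} (hf : Measurable f) (hg : Measurable g) :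
    Measurable fun z : R2n n => pairing (weyl r U z f) g := by
  have : Measurable fun y : R2n n × Rn n => weyl r U y.1 f y.2 * conj (g y.2) :=
    (measurable_weyl hf).mul (Complex.continuous_conj.measurable.comp (hg.comp measurable_snd))
  exact this.stronglyMeasurable.integral_prod_right.measurable

theorem measurable_pairing_weyl_right {f g : Rn n → ℂ} (hf : Measurable f) (hg : Measurable g) :
    Measurable fun z : R2n n => pairing f (weyl r U z g) := by
  simp_rw [← pairing_conj (weyl r U _ g) f]
  exact Complex.continuous_conj.measurable.comp (measurable_pairing_weyl hg hf)

end Weyl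

/-! ### The Gaussian wavelet and its matrix coefficient. -/

section Gaussian

variable {n : ℕ} {r : ℝ} {U : Rn n ≃ₗᵢ[ℝ] Rn n}

theorem continuous_gaussianWavelet : Continuous (gaussianWavelet n) := by
  unfold gaussianWavelet
  fun_prop

theorem integrable_exp_neg_mul_norm_sq {E : Type*} [NormedAddCommGroup E] [InnerProductSpace ℝ E]
    [FiniteDimensional ℝ E] [MeasurableSpace E] [BorelSpace E] {b : ℝ} (hb : 0 < b) :
    Integrable fun x : E => Real.exp (-b * ‖x‖ ^ 2) := by
  have := (GaussianFourier.integrable_cexp_neg_mul_sq_norm_add (V := E) (b := (b : ℂ))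
    (by simpa using hb) 0 0).norm
  refine this.congr (Filter.Eventually.of_forall fun x => ?_)
  simp only [zero_mul, add_zero, Complex.norm_exp]
  norm_cast

theorem norm_gaussianWavelet (x : Rn n) :
    ‖gaussianWavelet n x‖ = (2 : ℝ) ^ ((n : ℝ) / 4) * Real.exp (-‖x‖ ^ 2 / 2) := by
  rw [gaussianWavelet, Complex.norm_real, Real.norm_of_nonneg (by positivity)]

theorem memLp_gaussianWavelet : MemLp (gaussianWavelet n) 2 := by
  rw [memLp_two_iff_integrable_sq_norm continuous_gaussianWavelet.aestronglyMeasurable]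
  refine ((integrable_exp_neg_mul_norm_sq (E := Rn n) one_pos).const_mul
    (((2 : ℝ) ^ ((n : ℝ) / 4)) ^ 2)).congr (Filter.Eventually.of_forall fun x => ?_)
  simp only [norm_gaussianWavelet, mul_pow, ← Real.exp_nat_mul]
  congr 2
  push_cast
  ring

theorem norm_gaussianWavelet_le (x : Rn n) :
    ‖gaussianWavelet n x‖ ≤ (2 : ℝ) ^ ((n : ℝ) / 4) := by
  rw [norm_gaussianWavelet]
  refine mul_le_of_le_one_right (by positivity) (Real.exp_le_one_iff.2 ?_)
  have := sq_nonneg ‖x‖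
  linarith

/-- The quadratic form `|B_k ξ|² + |η|²` for `B_k = r U`. -/
def quad (r : ℝ) (z : R2n n) : ℝ := r ^ 2 * ‖z.fst‖ ^ 2 + ‖z.snd‖ ^ 2

/-- This ambiguity function of the Gaussian is the source of the factor exp(-Q/4) in `coeff`, and so
of the shift from c to c + 1/4. -/
theorem pairing_weyl_gaussianWavelet (z : R2n n) :
    pairing (weyl r U z (gaussianWavelet n)) (gaussianWavelet n) =
      (((2 * Real.pi) ^ ((n : ℝ) / 2) * Real.exp (-quad r z / 4) : ℝ) : ℂ) := by
  have h := GaussianFourier.integral_cexp_neg_mul_sq_norm_add (V := Rn n) (b := 1)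
    (by simp) (Complex.I * r) (U.symm z.fst)
  -- Centring at the midpoint of the two Gaussians lets the parallelogram law separate x from p; the
  -- x-integral is then the Fourier transform of a Gaussian.
  rw [pairing, ← integral_sub_right_eq_self _ ((1 / 2 : ℝ) • z.snd)]
  have hint : ∀ x : Rn n, weyl r U z (gaussianWavelet n) (x - (1 / 2 : ℝ) • z.snd) *
      conj (gaussianWavelet n (x - (1 / 2 : ℝ) • z.snd)) =
      (((2 : ℝ) ^ ((n : ℝ) / 2) * Real.exp (-‖z.snd‖ ^ 2 / 4) : ℝ) : ℂ) *
        Complex.exp (-1 * (‖x‖ : ℂ) ^ 2 +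
          Complex.I * r * ((inner ℝ (U.symm z.fst) x : ℝ) : ℂ)) := by
    intro x
    have h1 : (2 : ℝ) ^ ((n : ℝ) / 2) = (2 : ℝ) ^ ((n : ℝ) / 4) * (2 : ℝ) ^ ((n : ℝ) / 4) := by
      rw [← Real.rpow_add two_pos]
      ring_nf
    have h2 : inner ℝ z.fst (U x) = inner ℝ (U.symm z.fst) x := by
      rw [U.symm.inner_map_eq_flip, LinearIsometryEquiv.symm_symm]
    have h3 : x - (1 / 2 : ℝ) • z.snd + z.snd = x + (1 / 2 : ℝ) • z.snd := by
      module
    have h4 : ‖x + (1 / 2 : ℝ) • z.snd‖ ^ 2 + ‖x - (1 / 2 : ℝ) • z.snd‖ ^ 2 =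
        2 * ‖x‖ ^ 2 + ‖z.snd‖ ^ 2 / 2 := by
      have := parallelogram_law_with_norm ℝ x ((1 / 2 : ℝ) • z.snd)
      rw [norm_smul, Real.norm_of_nonneg (by norm_num)] at this
      linear_combination this
    rw [weyl, gaussianWavelet, gaussianWavelet, Complex.conj_ofReal, sub_add_cancel, h3, h2, h1,
      Complex.exp_add]
    have h5 : Real.exp (-‖x + (1 / 2 : ℝ) • z.snd‖ ^ 2 / 2) *
        Real.exp (-‖x - (1 / 2 : ℝ) • z.snd‖ ^ 2 / 2) =
        Real.exp (-‖z.snd‖ ^ 2 / 4) * Real.exp (-‖x‖ ^ 2) := by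
      rw [← Real.exp_add, ← Real.exp_add]
      congr 1
      linear_combination (-1 / 2) * h4
    have h6 : Complex.exp (-1 * (‖x‖ : ℂ) ^ 2) = ((Real.exp (-‖x‖ ^ 2) : ℝ) : ℂ) := by
      push_cast
      ring_nf
    have h5' := congrArg Complex.ofReal h5
    rw [Complex.ofReal_mul, Complex.ofReal_mul] at h5'
    rw [h6, Complex.ofReal_mul, Complex.ofReal_mul, Complex.ofReal_mul, Complex.ofReal_mul,
      Complex.ofReal_mul, mul_assoc Complex.I]
    linear_combination (Complex.exp (Complex.I * ((r : ℂ) * (inner ℝ (U.symm z.fst) x : ℝ))) *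
      (((2 : ℝ) ^ ((n : ℝ) / 4) : ℝ) : ℂ) * (((2 : ℝ) ^ ((n : ℝ) / 4) : ℝ) : ℂ)) * h5'
  simp_rw [hint]
  rw [integral_const_mul, h]
  have hpi : ((Real.pi : ℂ) / 1) ^ ((Module.finrank ℝ (Rn n) : ℂ) / 2) =
      ((Real.pi ^ ((n : ℝ) / 2) : ℝ) : ℂ) := by
    rw [Complex.ofReal_cpow Real.pi_pos.le, finrank_euclideanSpace, Fintype.card_fin]
    simp
  have hexp : Complex.exp ((Complex.I * r) ^ 2 * (‖U.symm z.fst‖ : ℂ) ^ 2 / (4 * 1)) =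
      ((Real.exp (-(r ^ 2 * ‖z.fst‖ ^ 2) / 4) : ℝ) : ℂ) := by
    rw [LinearIsometryEquiv.norm_map, mul_pow, Complex.I_sq]
    push_cast
    ring_nf
  rw [hpi, hexp, ← Complex.ofReal_mul, ← Complex.ofReal_mul]
  congr 1
  rw [Real.mul_rpow two_pos.le Real.pi_pos.le, quad,
    show -(r ^ 2 * ‖z.fst‖ ^ 2 + ‖z.snd‖ ^ 2) / 4 =
      -‖z.snd‖ ^ 2 / 4 + -(r ^ 2 * ‖z.fst‖ ^ 2) / 4 by ring, Real.exp_add]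
  ring

end Gaussian

/-! ### Fubini for the shear (x, p) ↦ (x, p + x). -/

section Shear

variable {n : ℕ}

theorem integrable_mul_shear {a b : Rn n → ℂ} (ha : Integrable a) (hb : Integrable b) :
    Integrable (fun y : Rn n × Rn n => a y.1 * b (y.2 + y.1)) (volume.prod volume) :=
  (measurePreserving_prod_add_right (volume : Measure (Rn n)) volume).integrable_comp_of_integrable
    (ha.mul_prod hb)

theorem integral_integral_mul_shear {a b : Rn n → ℂ} (ha : Integrable a) (hb : Integrable b) :
    ∫ p, ∫ x, a x * b (p + x) = (∫ x, a x) * ∫ x, b x := by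
  rw [← integral_integral_swap (f := fun x p => a x * b (p + x)) (integrable_mul_shear ha hb)]
  simp_rw [integral_const_mul, integral_add_right_eq_self b]
  rw [integral_mul_const]

end Shear

/-! ### Square integrability and the orthogonality relations. -/

section Orthogonality

variable {n : ℕ} {r : ℝ} {U : Rn n ≃ₗᵢ[ℝ] Rn n}

/-- For fixed p the coefficient is, up to a phase, a Fourier transform in q of a windowed function.
The orthogonality relations thus reduce to Plancherel in q followed by Fubini in p. -/
theorem pairing_weyl_eq_fourier (f φ : Rn n → ℂ) (q p : Rn n) :
    pairing f (weyl r U (WithLp.toLp 2 (q, p)) φ) =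
      Complex.exp (-Complex.I * ((r * inner ℝ q (U ((1 / 2 : ℝ) • p)) : ℝ) : ℂ)) *
        𝓕 (fun x => f x * conj (φ (p + x))) ((r / (2 * Real.pi)) • U.symm q) := by
  rw [pairing, Real.fourier_eq', ← integral_const_mul]
  congr 1 with x
  simp only [weyl, map_mul, smul_eq_mul, WithLp.toLp_fst, WithLp.toLp_snd]
  rw [← Complex.exp_conj, map_mul, Complex.conj_I, Complex.conj_ofReal, ← mul_assoc (Complex.exp _),
    ← Complex.exp_add, mul_left_comm, add_comm p x]
  congr 2
  rw [inner_smul_right, real_inner_comm (U.symm q) x, U.symm.inner_map_eq_flip, LinearIsometryEquiv.symm_symm,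
    map_add, inner_add_right]
  have : (Real.pi : ℂ) ≠ 0 := by exact_mod_cast Real.pi_ne_zero
  push_cast
  field_simp
  ring

theorem integral_comp_smul_symm {G : Type*} [NormedAddCommGroup G] [NormedSpace ℝ G] (hr : 0 < r)
    (h : Rn n → G) :
    ∫ q, h ((r / (2 * Real.pi)) • U.symm q) = ((2 * Real.pi / r) ^ n) • ∫ q, h q := by
  rw [U.symm.measurePreserving.integral_comp U.symm.toHomeomorph.measurableEmbedding
    (fun q => h ((r / (2 * Real.pi)) • q)), Measure.integral_comp_smul_of_nonneg]
  · rw [finrank_euclideanSpace, Fintype.card_fin, ← inv_pow, inv_div]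
  · have := Real.pi_pos
    positivity

theorem integrable_comp_smul_symm {G : Type*} [NormedAddCommGroup G] [NormedSpace ℝ G] (hr : 0 < r)
    {h : Rn n → G} (hh : Integrable h) :
    Integrable fun q => h ((r / (2 * Real.pi)) • U.symm q) :=
  U.symm.measurePreserving.integrable_comp_of_integrable
    (g := fun q => h ((r / (2 * Real.pi)) • q))
    (hh.comp_smul (div_pos hr (by positivity)).ne')

variable {f f₁ f₂ φ φ₁ φ₂ : Rn n → ℂ}

theorem integrable_mul_conj {α : Type*} [MeasurableSpace α] {μ : Measure α} {f g : α → ℂ}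
    (hf : MemLp f 2 μ) (hg : MemLp g 2 μ) : Integrable (fun x => f x * conj (g x)) μ :=
  hf.integrable_mul hg.star

theorem integrable_window (hf : MemLp f 2) (hφ : MemLp φ 2) (p : Rn n) :
    Integrable fun x => f x * conj (φ (p + x)) :=
  integrable_mul_conj hf (hφ.comp_measurePreserving (measurePreserving_add_left volume p))

/-- Boundedness of the window puts the product in L² for every p, so that Plancherel applies for
each p rather than almost every p. -/
theorem memLp_window (hf : MemLp f 2) (hφm : Measurable φ) {C : ℝ} (hC : ∀ x, ‖φ x‖ ≤ C)
    (p : Rn n) : MemLp (fun x => f x * conj (φ (p + x))) 2 := by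
  refine (hf.const_mul (C : ℂ)).mono (hf.1.mul (Complex.continuous_conj.measurable.comp
    (hφm.comp (measurable_const_add p))).aestronglyMeasurable) (Filter.Eventually.of_forall ?_)
  intro x
  rw [norm_mul, norm_mul, RCLike.norm_conj, mul_comm, Complex.norm_real]
  gcongr
  exact (hC _).trans (le_abs_self C)

theorem norm_sq_pairing_weyl (f φ : Rn n → ℂ) (q p : Rn n) :
    ‖pairing f (weyl r U (WithLp.toLp 2 (q, p)) φ)‖ ^ 2 =
      ‖𝓕 (fun x => f x * conj (φ (p + x))) ((r / (2 * Real.pi)) • U.symm q)‖ ^ 2 := by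
  rw [pairing_weyl_eq_fourier, norm_mul, neg_mul, mul_comm Complex.I, ← neg_mul,
    ← Complex.ofReal_neg, Complex.norm_exp_ofReal_mul_I, one_mul]

/-- Square integrability of the Schrödinger representation. -/
theorem memLp_pairing_weyl (hr : 0 < r) (hfm : Measurable f) (hf : MemLp f 2)
    (hφm : Measurable φ) (hφ : MemLp φ 2) {C : ℝ} (hC : ∀ x, ‖φ x‖ ≤ C) :
    MemLp (fun z : R2n n => pairing f (weyl r U z φ)) 2 := by
  have hmeas := measurable_pairing_weyl_right (r := r) (U := U) hfm hφm
  rw [memLp_two_iff_integrable_sq_norm hmeas.aestronglyMeasurable,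
    ← (WithLp.volume_preserving_toLp (U := Rn n) (V := Rn n)).integrable_comp_emb
      (MeasurableEquiv.toLp 2 _).measurableEmbedding, Measure.volume_eq_prod,
    integrable_prod_iff']
  swap
  · exact (((hmeas.norm.pow_const 2).comp
      (MeasurableEquiv.toLp 2 (Rn n × Rn n)).measurable)).aestronglyMeasurable
  simp only [Function.comp_apply, norm_sq_pairing_weyl, norm_pow, norm_norm]
  refine ⟨Filter.Eventually.of_forall fun p => ?_, ?_⟩
  · have := memLp_fourier (integrable_window hf hφ p) (memLp_window hf hφm hC p)
    exact integrable_comp_smul_symm hr ((memLp_two_iff_integrable_sq_norm this.1).1 this)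
  -- The squared norm is written as the norm of an integral of complex products so that
  -- `integrable_mul_shear` gives integrability in p.
  · have hint : ∀ p, ∫ q, ‖𝓕 (fun x => f x * conj (φ (p + x)))
        ((r / (2 * Real.pi)) • U.symm q)‖ ^ 2 =
        ((2 * Real.pi / r) ^ n) • ‖∫ x, (f x * conj (f x)) * (φ (p + x) * conj (φ (p + x)))‖ := by
      intro p
      rw [integral_comp_smul_symm hr (fun q => ‖𝓕 (fun x => f x * conj (φ (p + x))) q‖ ^ 2),
        integral_norm_sq_fourier (integrable_window hf hφ p) (memLp_window hf hφm hC p)]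
      congr 1
      have : ∀ x, (f x * conj (f x)) * (φ (p + x) * conj (φ (p + x))) =
          ((‖f x * conj (φ (p + x))‖ ^ 2 : ℝ) : ℂ) := by
        intro x
        rw [Complex.mul_conj, Complex.mul_conj, ← Complex.ofReal_mul, Complex.normSq_eq_norm_sq,
          Complex.normSq_eq_norm_sq, norm_mul, RCLike.norm_conj, mul_pow]
      simp_rw [this]
      rw [integral_complex_ofReal, Complex.norm_real, Real.norm_of_nonneg]
      exact integral_nonneg fun x => by positivity
    simp_rw [hint]
    exact (integrable_mul_shear (integrable_mul_conj hf hf)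
      (integrable_mul_conj hφ hφ)).integral_prod_right.norm.smul ((2 * Real.pi / r) ^ n)

/-- The orthogonality relations of the Schrödinger representation. -/
theorem integral_pairing_weyl_mul_conj (hr : 0 < r)
    (hfm₁ : Measurable f₁) (hf₁ : MemLp f₁ 2) (hfm₂ : Measurable f₂) (hf₂ : MemLp f₂ 2)
    (hφm₁ : Measurable φ₁) (hφ₁ : MemLp φ₁ 2) (hφm₂ : Measurable φ₂) (hφ₂ : MemLp φ₂ 2)
    {C : ℝ} (hC₁ : ∀ x, ‖φ₁ x‖ ≤ C) (hC₂ : ∀ x, ‖φ₂ x‖ ≤ C) :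
    ∫ z : R2n n, pairing f₁ (weyl r U z φ₁) * conj (pairing f₂ (weyl r U z φ₂)) =
      ((2 * Real.pi / r) ^ n : ℝ) * (pairing f₁ f₂ * pairing φ₂ φ₁) := by
  have hI := integrable_mul_conj (memLp_pairing_weyl (U := U) hr hfm₁ hf₁ hφm₁ hφ₁ hC₁)
    (memLp_pairing_weyl (U := U) hr hfm₂ hf₂ hφm₂ hφ₂ hC₂)
  have hmp := WithLp.volume_preserving_toLp (U := Rn n) (V := Rn n)
  have hI' : Integrable (fun y : Rn n × Rn n =>
      pairing f₁ (weyl r U (WithLp.toLp 2 y) φ₁) *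
        conj (pairing f₂ (weyl r U (WithLp.toLp 2 y) φ₂))) (volume.prod volume) :=
    (hmp.integrable_comp_emb (MeasurableEquiv.toLp 2 _).measurableEmbedding).2 hI
  rw [← hmp.integral_comp (MeasurableEquiv.toLp 2 _).measurableEmbedding, Measure.volume_eq_prod,
    integral_prod_symm _ hI']
  have hq : ∀ p, ∫ q, pairing f₁ (weyl r U (WithLp.toLp 2 (q, p)) φ₁) *
      conj (pairing f₂ (weyl r U (WithLp.toLp 2 (q, p)) φ₂)) =
      ((2 * Real.pi / r) ^ n : ℝ) *
        ∫ x, (f₁ x * conj (f₂ x)) * (φ₂ (p + x) * conj (φ₁ (p + x))) := by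
    intro p
    have h1 : ∀ q, pairing f₁ (weyl r U (WithLp.toLp 2 (q, p)) φ₁) *
      conj (pairing f₂ (weyl r U (WithLp.toLp 2 (q, p)) φ₂)) =
      𝓕 (fun x => f₁ x * conj (φ₁ (p + x))) ((r / (2 * Real.pi)) • U.symm q) *
        conj (𝓕 (fun x => f₂ x * conj (φ₂ (p + x))) ((r / (2 * Real.pi)) • U.symm q)) := by
      intro q
      rw [pairing_weyl_eq_fourier, pairing_weyl_eq_fourier, map_mul, mul_mul_mul_comm,
        Complex.mul_conj, Complex.normSq_eq_norm_sq, neg_mul, mul_comm Complex.I, ← neg_mul,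
        ← Complex.ofReal_neg, Complex.norm_exp_ofReal_mul_I]
      simp
    simp_rw [h1]
    rw [integral_comp_smul_symm hr (fun q => 𝓕 (fun x => f₁ x * conj (φ₁ (p + x))) q *
        conj (𝓕 (fun x => f₂ x * conj (φ₂ (p + x))) q)),
      integral_fourier_mul_conj (integrable_window hf₁ hφ₁ p) (memLp_window hf₁ hφm₁ hC₁ p)
        (integrable_window hf₂ hφ₂ p) (memLp_window hf₂ hφm₂ hC₂ p), Complex.real_smul]
    congr 2 with x
    rw [map_mul, Complex.conj_conj]
    ring
  simp_rw [hq]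
  rw [integral_const_mul, integral_integral_mul_shear (integrable_mul_conj hf₁ hf₂)
    (integrable_mul_conj hφ₂ hφ₁), pairing, pairing]

end Orthogonality

/-! ### From the symbol to the coefficient of the superposition. -/

section Symbol

variable {n : ℕ} {r : ℝ} {U : Rn n ≃ₗᵢ[ℝ] Rn n}

theorem weyl_neg_weyl (z : R2n n) (u : Rn n → ℂ) : weyl r U z (weyl r U (-z) u) = u := by
  rw [weyl_weyl, add_neg_cancel, weyl_zero, phase_antisymm, phase_neg_left, phase_self]
  simp

theorem weyl_comm (z w : R2n n) (u : Rn n → ℂ) :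
    weyl r U w (weyl r U z u) = fun x =>
      Complex.exp (-(Complex.I * ((2 * phase r U z w : ℝ) : ℂ))) * weyl r U z (weyl r U w u) x := by
  simp only [weyl_weyl, ← mul_assoc, ← Complex.exp_add]
  rw [phase_antisymm z w, add_comm w z]
  ext x
  congr 2
  push_cast
  ring

theorem pairing_weyl_weyl (z : R2n n) (f g : Rn n → ℂ) :
    pairing (weyl r U z f) (weyl r U z g) = pairing f g := by
  have h := weyl_neg_weyl (r := r) (U := U) (-z) g
  rw [neg_neg] at h
  rw [pairing_weyl, h]

/-- The commutator phase of π is an ordinary character after the rotation. This is why the twisted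
symbol F^k, and not F, enters with the usual Fourier transform. -/
theorem inner_rotation_symm (ζ z : R2n n) :
    inner ℝ ζ (r • (rotation U).symm z) = 2 * phase r U ζ z := by
  rw [inner_smul_right, WithLp.prod_inner_apply, rotation_symm_apply, phase]
  simp only [inner_neg_right]
  change r * (-inner ℝ ζ.fst _ + inner ℝ ζ.snd _) = _
  rw [real_inner_comm (U.symm z.fst) ζ.snd, LinearIsometryEquiv.inner_map_eq_flip,
    LinearIsometryEquiv.symm_symm]
  ring

/-- The product `⟨f, π(z) φ⟩ ⟨π(z) φ, g⟩` for the Gaussian wavelet `φ`. -/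
def wavelet (r : ℝ) (U : Rn n ≃ₗᵢ[ℝ] Rn n) (f g : Rn n → ℂ) (z : R2n n) : ℂ :=
  pairing f (weyl r U z (gaussianWavelet n)) * pairing (weyl r U z (gaussianWavelet n)) g

variable {f g : Rn n → ℂ}

theorem memLp_pairing_gaussian (hr : 0 < r) (hfm : Measurable f) (hf : MemLp f 2) :
    MemLp (fun z : R2n n => pairing f (weyl r U z (gaussianWavelet n))) 2 :=
  memLp_pairing_weyl hr hfm hf continuous_gaussianWavelet.measurable memLp_gaussianWavelet
    norm_gaussianWavelet_le

theorem integrable_wavelet (hr : 0 < r) (hfm : Measurable f) (hf : MemLp f 2) (hgm : Measurable g)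
    (hg : MemLp g 2) : Integrable (wavelet r U f g) :=
  (integrable_mul_conj (memLp_pairing_gaussian (U := U) hr hfm hf)
    (memLp_pairing_gaussian (U := U) hr hgm hg)).congr
      (Filter.Eventually.of_forall fun z => by simp only [wavelet, pairing_conj])

theorem memLp_wavelet (hr : 0 < r) (hfm : Measurable f) (hf : MemLp f 2) (hgm : Measurable g)
    (hg : MemLp g 2) : MemLp (wavelet r U f g) 2 := by
  refine ((memLp_pairing_gaussian (U := U) hr hfm hf).const_mul
    (((eLpNorm (gaussianWavelet n) 2 volume).toReal * (eLpNorm g 2 volume).toReal : ℝ) : ℂ)).mono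
    (integrable_wavelet hr hfm hf hgm hg).1 (Filter.Eventually.of_forall fun z => ?_)
  rw [wavelet, norm_mul, norm_mul, mul_comm, Complex.norm_real, Real.norm_of_nonneg (by positivity)]
  gcongr
  exact norm_pairing_weyl_le continuous_gaussianWavelet.measurable memLp_gaussianWavelet hg z

/-- The symplectic Fourier transform of `⟨f, π(z) φ⟩ ⟨π(z) φ, g⟩`. -/
theorem integral_exp_mul_wavelet (hr : 0 < r) (hfm : Measurable f) (hf : MemLp f 2)
    (hgm : Measurable g) (hg : MemLp g 2) (ζ : R2n n) :
    ∫ z, Complex.exp (Complex.I * ((inner ℝ ζ (r • (rotation U).symm z) : ℝ) : ℂ)) *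
        wavelet r U f g z =
      ((2 * Real.pi / r) ^ n * ((2 * Real.pi) ^ ((n : ℝ) / 2) * Real.exp (-quad r ζ / 4)) : ℝ) *
        pairing (weyl r U ζ f) g := by
  have hG := continuous_gaussianWavelet (n := n).measurable
  -- Orthogonality is applied with g and φ both moved by π(-ζ). Commuting π(z) past π(-ζ) yields the
  -- character, and unitarity then removes π(-ζ) from the integrand.
  have h := integral_pairing_weyl_mul_conj (U := U) hr hfm hf
    (measurable_weyl_right hgm (-ζ)) (memLp_weyl (r := r) (U := U) hgm hg (-ζ)) hG
    memLp_gaussianWavelet (measurable_weyl_right hG (-ζ))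
    (memLp_weyl (r := r) (U := U) hG memLp_gaussianWavelet (-ζ))
    norm_gaussianWavelet_le (fun x => (norm_weyl _ _ x).le.trans (norm_gaussianWavelet_le _))
  rw [pairing_weyl_gaussianWavelet, ← pairing_weyl] at h
  have hq : quad r (-ζ) = quad r ζ := by simp [quad]
  rw [hq] at h
  refine Eq.trans ?_ (h.trans ?_)
  · congr 1 with z
    rw [weyl_comm (-ζ) z, pairing_const_mul_right, pairing_weyl_weyl, map_mul, Complex.conj_conj,
      pairing_conj, phase_neg_left, inner_rotation_symm, wavelet]
    push_cast
    rw [mul_neg, mul_neg, neg_neg]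
    ring
  · push_cast
    ring

theorem finrank_R2n : Module.finrank ℝ (R2n n) = 2 * n := by
  rw [(WithLp.linearEquiv 2 ℝ (Rn n × Rn n)).finrank_eq]
  simp [two_mul]

theorem integral_comp_smul_rotation (hr : 0 < r) (h : R2n n → ℂ) :
    ∫ z, h (r⁻¹ • rotation U z) = (r ^ (2 * n) : ℝ) * ∫ z, h z := by
  rw [(rotation U).measurePreserving.integral_comp (rotation U).toHomeomorph.measurableEmbedding
    (fun z => h (r⁻¹ • z)), Measure.integral_comp_inv_smul_of_nonneg volume h hr.le,
    finrank_R2n, Complex.real_smul]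

/-- Parseval pairs the symbol with a conjugate, so the test function is the conjugated wavelet
product. The point ζ/(2π) converts to the kernel exp(-iζ·z). -/
theorem conj_fourier_conj_wavelet (hr : 0 < r) (hfm : Measurable f) (hf : MemLp f 2)
    (hgm : Measurable g) (hg : MemLp g 2) (ζ : R2n n) :
    conj (𝓕 (fun z => conj (wavelet r U f g (r⁻¹ • rotation U z))) ((2 * Real.pi)⁻¹ • ζ)) =
      (r ^ (2 * n) : ℝ) * (((2 * Real.pi / r) ^ n *
        ((2 * Real.pi) ^ ((n : ℝ) / 2) * Real.exp (-quad r ζ / 4)) : ℝ) *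
        pairing (weyl r U ζ f) g) := by
  rw [← integral_exp_mul_wavelet hr hfm hf hgm hg, ← integral_comp_smul_rotation (U := U) hr
    (fun z => Complex.exp (Complex.I * ((inner ℝ ζ (r • (rotation U).symm z) : ℝ) : ℂ)) *
        wavelet r U f g z), Real.fourier_eq', ← integral_conj]
  congr 1 with z
  rw [smul_eq_mul, map_mul, Complex.conj_conj, ← Complex.exp_conj, map_mul, Complex.conj_I,
    Complex.conj_ofReal, map_smul, smul_inv_smul₀ hr.ne', LinearIsometryEquiv.symm_apply_apply,
    inner_smul_right, real_inner_comm ζ z]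
  congr 2
  have : (Real.pi : ℂ) ≠ 0 := by exact_mod_cast Real.pi_ne_zero
  push_cast
  field_simp

/-- The coefficient of `π(ζ)` in the expansion of a localization operator as a superposition of
the operators `π(ζ)`, where `u` is the twisted symbol. -/
def coeff (r : ℝ) (u : Lp ℂ 2 (volume : Measure (R2n n))) (ζ : R2n n) : ℂ :=
  ((((2 * Real.pi) ^ ((n : ℝ) / 2))⁻¹ * Real.exp (-quad r ζ / 4) : ℝ) : ℂ) * hat u ζ

theorem integral_mul_wavelet (hr : 0 < r) {F : R2n n → ℂ}
    (hF : MemLp (fun z => F (r⁻¹ • rotation U z)) 2) (hfm : Measurable f) (hf : MemLp f 2)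
    (hgm : Measurable g) (hg : MemLp g 2) :
    (((2 * Real.pi) ^ n)⁻¹ * r ^ n : ℝ) * ∫ z, F z * wavelet r U f g z =
      ∫ ζ, coeff r (hF.toLp _) ζ * pairing (weyl r U ζ f) g := by
  have hW : Integrable fun z => wavelet r U f g (r⁻¹ • rotation U z) :=
    (rotation U).measurePreserving.integrable_comp_of_integrable
      (g := fun z => wavelet r U f g (r⁻¹ • z))
      ((integrable_wavelet hr hfm hf hgm hg).comp_smul (inv_ne_zero hr.ne'))
  have hW2 : MemLp (fun z => wavelet r U f g (r⁻¹ • rotation U z)) 2 := by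
    rw [memLp_two_iff_integrable_sq_norm hW.1]
    exact (rotation U).measurePreserving.integrable_comp_of_integrable
      (g := fun z => ‖wavelet r U f g (r⁻¹ • z)‖ ^ 2)
      (((memLp_two_iff_integrable_sq_norm (integrable_wavelet hr hfm hf hgm hg).1).1
        (memLp_wavelet hr hfm hf hgm hg)).comp_smul (inv_ne_zero hr.ne'))
  have hWc : Integrable fun z => conj (wavelet r U f g (r⁻¹ • rotation U z)) :=
    Complex.conjLIE.integrable_comp_iff.2 hW
  have h1 := integral_comp_smul_rotation (U := U) hr (fun z => F z * wavelet r U f g z)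
  have h2 := integral_mul_conj_eq_fourier hF hWc hW2.star
  simp only [Complex.conj_conj] at h2
  -- This rescaling by 2π costs (2π)^(2n) in dimension 2n; the rotated substitution in `h1` costs
  -- r^(2n). The rest is bookkeeping of these constants.
  have h3 := Measure.integral_comp_inv_smul_of_nonneg volume
    (fun w : R2n n => (𝓕 (hF.toLp _) : Lp ℂ 2 (volume : Measure (R2n n))) w *
      conj (𝓕 (fun z => conj (wavelet r U f g (r⁻¹ • rotation U z))) w))
      (R := 2 * Real.pi) (by positivity)
  rw [← h2, h1, finrank_R2n, Complex.real_smul] at h3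
  simp_rw [conj_fourier_conj_wavelet (U := U) hr hfm hf hgm hg] at h3
  have hpi : (Real.pi : ℂ) ≠ 0 := by exact_mod_cast Real.pi_ne_zero
  have hr' : (r : ℂ) ≠ 0 := by exact_mod_cast hr.ne'
  have h4 : ∀ ζ : R2n n, (𝓕 (hF.toLp _) : Lp ℂ 2 (volume : Measure (R2n n)))
      ((2 * Real.pi)⁻¹ • ζ) * ((r ^ (2 * n) : ℝ) * (((2 * Real.pi / r) ^ n *
        ((2 * Real.pi) ^ ((n : ℝ) / 2) * Real.exp (-quad r ζ / 4)) : ℝ) *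
        pairing (weyl r U ζ f) g)) =
      (r ^ n * (2 * Real.pi) ^ (3 * n) : ℝ) *
        (coeff r (hF.toLp _) ζ * pairing (weyl r U ζ f) g) := by
    intro ζ
    have h5 : (2 * Real.pi) ^ ((n : ℝ) / 2) * (2 * Real.pi) ^ ((n : ℝ) / 2) =
        (2 * Real.pi) ^ n := by
      rw [← Real.rpow_add (by positivity), add_halves, Real.rpow_natCast]
    have h7 : r ^ (2 * n) * ((2 * Real.pi / r) ^ n *
        ((2 * Real.pi) ^ ((n : ℝ) / 2) * Real.exp (-quad r ζ / 4))) =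
        r ^ n * (2 * Real.pi) ^ (3 * n) * (((2 * Real.pi) ^ ((n : ℝ) / 2))⁻¹ *
          Real.exp (-quad r ζ / 4)) * ((2 * Real.pi) ^ n)⁻¹ := by
      rw [div_pow, two_mul n, pow_add r, show 3 * n = n + n + n by ring, pow_add (2 * Real.pi),
        pow_add (2 * Real.pi)]
      have := hr.ne'
      field_simp
      rw [pow_two, h5]
    have h7' := congrArg Complex.ofReal h7
    simp only [Complex.ofReal_mul _ (((2 * Real.pi) ^ n)⁻¹), Complex.ofReal_mul (r ^ (2 * n)),
      Complex.ofReal_mul (r ^ n * (2 * Real.pi) ^ (3 * n))] at h7'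
    rw [coeff, hat, ← mul_assoc ((r ^ (2 * n) : ℝ) : ℂ), h7']
    ring
  simp_rw [h4] at h3
  rw [integral_const_mul] at h3
  have h8 : ((r ^ n * (2 * Real.pi) ^ (3 * n) : ℝ) : ℂ) ≠ 0 := by
    rw [Complex.ofReal_ne_zero]
    positivity
  apply mul_left_cancel₀ h8
  rw [h3]
  push_cast
  rw [show 3 * n = n + 2 * n by ring, pow_add (2 * (Real.pi : ℂ)), two_mul n, pow_add (r : ℂ)]
  field_simp

end Symbol

/-! ### Superpositions of the π(ζ) and their composition. -/

section Superposition

variable {n : ℕ} {r : ℝ} {U : Rn n ≃ₗᵢ[ℝ] Rn n}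

theorem measurable_coe (f : Lp ℂ 2 (volume : Measure (Rn n))) : Measurable f :=
  (Lp.stronglyMeasurable f).measurable

theorem weyl_congr_ae {f g : Rn n → ℂ} (h : f =ᵐ[volume] g) (z : R2n n) :
    weyl r U z f =ᵐ[volume] weyl r U z g := by
  filter_upwards [(measurePreserving_add_right volume z.snd).quasiMeasurePreserving.ae_eq h]
    with x hx
  simp only [Function.comp_apply] at hx
  simp only [weyl, hx]

variable (r U) in
/-- The unitary operator `π(z)` on `L²(ℝⁿ)`. -/
def weylLp (z : R2n n) (f : Lp ℂ 2 (volume : Measure (Rn n))) :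
    Lp ℂ 2 (volume : Measure (Rn n)) :=
  (memLp_weyl (r := r) (U := U) (measurable_coe f) (Lp.memLp f) z).toLp _

theorem coeFn_weylLp (z : R2n n) (f : Lp ℂ 2 (volume : Measure (Rn n))) :
    weylLp r U z f =ᵐ[volume] weyl r U z f := MemLp.coeFn_toLp _

theorem weylLp_add (z : R2n n) (f g : Lp ℂ 2 (volume : Measure (Rn n))) :
    weylLp r U z (f + g) = weylLp r U z f + weylLp r U z g := by
  refine Lp.ext ?_
  filter_upwards [coeFn_weylLp (r := r) (U := U) z (f + g), coeFn_weylLp (r := r) (U := U) z f,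
    coeFn_weylLp (r := r) (U := U) z g, Lp.coeFn_add (weylLp r U z f) (weylLp r U z g),
    weyl_congr_ae (r := r) (U := U) (Lp.coeFn_add f g) z] with x h1 h2 h3 h4 h5
  rw [h1, h4, Pi.add_apply, h2, h3, h5]
  simp only [weyl, Pi.add_apply, mul_add]

theorem weylLp_smul (z : R2n n) (c : ℂ) (f : Lp ℂ 2 (volume : Measure (Rn n))) :
    weylLp r U z (c • f) = c • weylLp r U z f := by
  refine Lp.ext ?_
  filter_upwards [coeFn_weylLp (r := r) (U := U) z (c • f), coeFn_weylLp (r := r) (U := U) z f,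
    Lp.coeFn_smul c (weylLp r U z f),
    weyl_congr_ae (r := r) (U := U) (Lp.coeFn_smul c f) z] with x h1 h2 h3 h4
  rw [h1, h3, Pi.smul_apply, h2, h4]
  simp only [weyl, Pi.smul_apply, smul_eq_mul]
  ring

theorem norm_weylLp (z : R2n n) (f : Lp ℂ 2 (volume : Measure (Rn n))) :
    ‖weylLp r U z f‖ = ‖f‖ := by
  rw [weylLp, Lp.norm_toLp, eLpNorm_weyl (measurable_coe f), Lp.norm_def]

theorem inner_weylLp (z : R2n n) (f g : Lp ℂ 2 (volume : Measure (Rn n))) :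
    inner ℂ (weylLp r U z f) g = conj (pairing (weyl r U z f) g) := by
  rw [pairing_conj, L2.inner_def]
  refine integral_congr_ae ?_
  filter_upwards [coeFn_weylLp (r := r) (U := U) z f] with x hx
  simp [hx]

theorem pairing_coe (f g : Lp ℂ 2 (volume : Measure (Rn n))) : pairing f g = inner ℂ g f := by
  rw [L2.inner_def]
  rfl

theorem measurable_inner_weylLp (f g : Lp ℂ 2 (volume : Measure (Rn n))) :
    Measurable fun z => inner ℂ (weylLp r U z f) g := by
  simp_rw [inner_weylLp]
  exact Complex.continuous_conj.measurable.comp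
    (measurable_pairing_weyl (measurable_coe f) (measurable_coe g))

theorem integrable_mul_inner_weylLp {a : R2n n → ℂ} (ha : Integrable a)
    (f g : Lp ℂ 2 (volume : Measure (Rn n))) :
    Integrable fun z => a z * inner ℂ (weylLp r U z f) g :=
  ha.mul_bdd (c := ‖f‖ * ‖g‖) (measurable_inner_weylLp f g).aestronglyMeasurable
    (Filter.Eventually.of_forall fun z => by
      rw [← norm_weylLp (r := r) (U := U) z f]
      exact norm_inner_le_norm _ _)

variable (r U) in
/-- `T = ∫ a(ζ) π(ζ) dζ` in the weak sense. -/
def IsSuperposition (a : R2n n → ℂ)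
    (T : Lp ℂ 2 (volume : Measure (Rn n)) →L[ℂ] Lp ℂ 2 (volume : Measure (Rn n))) : Prop :=
  ∀ f g : Lp ℂ 2 (volume : Measure (Rn n)),
    pairing (T f) g = ∫ ζ, a ζ * pairing (weyl r U ζ f) g

/-- The weak integral is a sesquilinear form bounded by the L¹ norm of a, because each π(ζ) is an
isometry; Riesz representation turns it into an operator. -/
theorem exists_isSuperposition {a : R2n n → ℂ} (ha : Integrable a) :
    ∃ T, IsSuperposition r U a T := by
  -- The inner product is conjugate-linear in its first slot, so the form representing T carries the
  -- conjugate of a.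
  have hac : Integrable fun ζ => conj (a ζ) := Complex.conjLIE.integrable_comp_iff.2 ha
  have hI := fun v w => integrable_mul_inner_weylLp (r := r) (U := U) hac v w
  let S : Lp ℂ 2 (volume : Measure (Rn n)) →ₗ⋆[ℂ] Lp ℂ 2 (volume : Measure (Rn n)) →ₗ[ℂ] ℂ :=
    LinearMap.mk₂'ₛₗ (starRingEnd ℂ) (RingHom.id ℂ)
      (fun v w => ∫ ζ, conj (a ζ) * inner ℂ (weylLp r U ζ v) w)
      (fun v v' w => by
        simp only [weylLp_add, inner_add_left, mul_add]
        exact integral_add (hI v w) (hI v' w))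
      (fun c v w => by
        simp only [weylLp_smul, inner_smul_left, mul_left_comm _ (conj c)]
        rw [integral_const_mul, smul_eq_mul])
      (fun v w w' => by
        simp only [inner_add_right, mul_add]
        exact integral_add (hI v w) (hI v w'))
      (fun c v w => by
        simp only [inner_smul_right, mul_left_comm _ c]
        rw [integral_const_mul, smul_eq_mul, RingHom.id_apply])
  have hS : ∀ v w, ‖S v w‖ ≤ (∫ ζ, ‖a ζ‖) * ‖v‖ * ‖w‖ := by
    intro v w
    rw [mul_assoc, ← integral_mul_const]
    refine norm_integral_le_of_norm_le (ha.norm.mul_const _) (Filter.Eventually.of_forall fun ζ => ?_)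
    rw [norm_mul, RCLike.norm_conj]
    gcongr
    rw [← norm_weylLp (r := r) (U := U) ζ v]
    exact norm_inner_le_norm _ _
  refine ⟨InnerProductSpace.continuousLinearMapOfBilin (S.mkContinuous₂ _ hS), fun f g => ?_⟩
  rw [pairing_coe, ← inner_conj_symm, InnerProductSpace.continuousLinearMapOfBilin_apply,
    LinearMap.mkContinuous₂_apply, LinearMap.mk₂'ₛₗ_apply, ← integral_conj]
  simp [inner_weylLp]

variable (r U) in
/-- The twisted convolution of `a` and `b`. -/
def twistedConv (a b : R2n n → ℂ) (u : R2n n) : ℂ :=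
  ∫ v, a (u - v) * b v * Complex.exp (Complex.I * (phase r U (u - v) v : ℂ))

/-- Moving π(w) onto g exposes T, whose expansion gives π(w)π(v) = exp(iθ(w,v)) π(w+v). The
substitution u = w + v then collects the coefficient of π(u); Fubini is justified since the matrix
coefficients are bounded. -/
theorem IsSuperposition.comp {a b : R2n n → ℂ} (ha : Integrable a) (hb : Integrable b)
    {S T : Lp ℂ 2 (volume : Measure (Rn n)) →L[ℂ] Lp ℂ 2 (volume : Measure (Rn n))}
    (hS : IsSuperposition r U a S) (hT : IsSuperposition r U b T) :
    IsSuperposition r U (twistedConv r U a b) (S.comp T) := by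
  intro f g
  set P : R2n n → ℂ := fun ζ => pairing (weyl r U ζ f) g with hP
  have hPm : Measurable P := measurable_pairing_weyl (measurable_coe f) (measurable_coe g)
  set N : R2n n → R2n n → ℂ := fun w v =>
    a w * b v * (Complex.exp (Complex.I * (phase r U w v : ℂ)) * P (w + v)) with hN
  have hstep : ∀ w, a w * pairing (weyl r U w (T f)) g = ∫ v, N w v := by
    intro w
    have h1 := hT f (weylLp r U (-w) g)
    rw [pairing_weyl, ← pairing_congr_ae (Filter.EventuallyEq.refl _ _)
      (coeFn_weylLp (r := r) (U := U) (-w) g), h1, ← integral_const_mul]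
    congr 1 with v
    rw [pairing_congr_ae (Filter.EventuallyEq.refl _ _)
      (coeFn_weylLp (r := r) (U := U) (-w) g), ← pairing_weyl, weyl_weyl,
      pairing_const_mul_left]
    simp only [hN, hP]
    ring
  have hNi : Integrable (Function.uncurry N) (volume.prod volume) := by
    refine (ha.mul_prod hb).mul_bdd
      (c := (eLpNorm f 2 volume).toReal * (eLpNorm g 2 volume).toReal) ?_
      (Filter.Eventually.of_forall fun y => ?_)
    · refine Measurable.aestronglyMeasurable (Measurable.mul ?_ (hPm.comp measurable_add))
      have := continuous_phase (r := r) (U := U)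
      exact (by fun_prop : Continuous fun y : R2n n × R2n n =>
        Complex.exp (Complex.I * (phase r U y.1 y.2 : ℂ))).measurable
    · rw [norm_mul, mul_comm Complex.I, Complex.norm_exp_ofReal_mul_I, one_mul]
      exact norm_pairing_weyl_le (measurable_coe f) (Lp.memLp f) (Lp.memLp g) _
  have hNs : Integrable (Function.uncurry fun u v => N (u - v) v) (volume.prod volume) :=
    (measurePreserving_sub_prod (volume : Measure (R2n n)) volume).integrable_comp_of_integrable hNi
  rw [ContinuousLinearMap.comp_apply, hS]
  simp_rw [hstep]
  rw [integral_integral_swap hNi]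
  have hsub : ∫ v, ∫ w, N w v = ∫ v, ∫ u, N (u - v) v := by
    congr 1 with v
    exact (integral_sub_right_eq_self (fun w => N w v) v).symm
  rw [hsub, ← integral_integral_swap hNs]
  congr 1 with u
  rw [twistedConv, ← integral_mul_const]
  congr 1 with v
  simp only [hN, sub_add_cancel]
  ring

end Superposition

/-! ### Twisted convolution of functions with Gaussian decay. -/

section Gaussian

variable {n : ℕ} {r : ℝ} {U : Rn n ≃ₗᵢ[ℝ] Rn n}

theorem continuous_quad : Continuous (quad (n := n) r) := by
  unfold quad
  fun_prop

theorem quad_nonneg (z : R2n n) : 0 ≤ quad r z := by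
  unfold quad
  positivity

/-- The parallelogram law for `quad`. -/
theorem quad_sub_add_quad (u v : R2n n) :
    quad r (u - v) + quad r v = quad r u / 2 + 2 * quad r (v - (1 / 2 : ℝ) • u) := by
  simp only [quad, WithLp.sub_fst, WithLp.sub_snd, WithLp.smul_fst, WithLp.smul_snd,
    norm_sub_sq_real, norm_smul, inner_smul_right, mul_pow, Real.norm_eq_abs, sq_abs,
    real_inner_comm u.fst, real_inner_comm u.snd]
  ring

theorem integrable_exp_neg_quad (hr : 0 < r) {b : ℝ} (hb : 0 < b) :
    Integrable fun z : R2n n => Real.exp (-b * quad r z) := by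
  rw [← (WithLp.volume_preserving_toLp (U := Rn n) (V := Rn n)).integrable_comp_emb
      (MeasurableEquiv.toLp 2 _).measurableEmbedding, Measure.volume_eq_prod]
  refine ((integrable_exp_neg_mul_norm_sq (E := Rn n) (by positivity : 0 < b * r ^ 2)).mul_prod
    (integrable_exp_neg_mul_norm_sq (E := Rn n) hb)).congr (Filter.Eventually.of_forall fun y => ?_)
  simp only [Function.comp_apply, quad, ← Real.exp_add, WithLp.toLp_fst, WithLp.toLp_snd]
  congr 1
  ring

theorem memLp_exp_neg_quad (hr : 0 < r) {b : ℝ} (hb : 0 < b) :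
    MemLp (fun z : R2n n => ((Real.exp (-b * quad r z) : ℝ) : ℂ)) 2 := by
  have hc := continuous_quad (n := n) (r := r)
  have hm : Continuous fun z : R2n n => ((Real.exp (-b * quad r z) : ℝ) : ℂ) := by fun_prop
  rw [memLp_two_iff_integrable_sq_norm hm.aestronglyMeasurable]
  refine (integrable_exp_neg_quad hr (mul_pos two_pos hb)).congr
    (Filter.Eventually.of_forall fun z => ?_)
  simp only [Complex.norm_real, Real.norm_of_nonneg (Real.exp_pos _).le, ← Real.exp_nat_mul]
  congr 1
  push_cast
  ring

theorem eLpNorm_two_sq {α : Type*} [MeasurableSpace α] (μ : Measure α) (h : α → ℂ) :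
    eLpNorm h 2 μ ^ 2 = ∫⁻ x, ‖h x‖ₑ ^ 2 ∂μ := by
  have := eLpNorm_nnreal_pow_eq_lintegral (μ := μ) (f := h) (p := 2) two_ne_zero
  have h2 : ∀ x : ℝ≥0∞, x ^ ((2 : NNReal) : ℝ) = x ^ 2 := fun x => by
    rw [← ENNReal.rpow_natCast]
    norm_num
  simp only [h2] at this
  exact this

theorem enorm_integral_mul_le {α : Type*} [MeasurableSpace α] {μ : Measure α} {a b : α → ℂ}
    (ha : AEStronglyMeasurable a μ) (hb : AEStronglyMeasurable b μ) :
    ‖∫ x, a x * b x ∂μ‖ₑ ≤ eLpNorm a 2 μ * eLpNorm b 2 μ := by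
  refine (enorm_integral_le_lintegral_enorm _).trans ?_
  rw [← eLpNorm_one_eq_lintegral_enorm]
  have h := eLpNorm_le_eLpNorm_mul_eLpNorm'_of_norm (p := 2) (q := 2) (r := 1) ha hb
    (fun x y => x * y) 1 (Filter.Eventually.of_forall fun x => by simp)
  rwa [ENNReal.coe_one, one_mul] at h

variable (r U) in
/-- The Gaussian-damped twisted convolution. -/
def dampedConv (δ : ℝ) (f g : R2n n → ℂ) (u : R2n n) : ℂ :=
  ∫ v, (((Real.exp (-δ * quad r (v - (1 / 2 : ℝ) • u)) : ℝ) : ℂ)) *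
    (f (u - v) * g v * Complex.exp (Complex.I * (phase r U (u - v) v : ℂ)))

variable {f g : R2n n → ℂ}

theorem continuous_exp_phase_sub : Continuous fun y : R2n n × R2n n =>
    Complex.exp (Complex.I * (phase r U (y.1 - y.2) y.2 : ℂ)) := by
  have h := (continuous_phase (r := r) (U := U)).comp
    (by fun_prop : Continuous fun y : R2n n × R2n n => (y.1 - y.2, y.2))
  simp only [Function.comp_def] at h
  fun_prop

theorem measurable_dampedConv (hf : Measurable f) (hg : Measurable g) (δ : ℝ) :
    Measurable (dampedConv r U δ f g) := by
  have h1 : Continuous fun y : R2n n × R2n n =>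
      ((Real.exp (-δ * quad r (y.2 - (1 / 2 : ℝ) • y.1)) : ℝ) : ℂ) := by
    have := continuous_quad (n := n) (r := r)
    fun_prop
  have : Measurable fun y : R2n n × R2n n =>
      (((Real.exp (-δ * quad r (y.2 - (1 / 2 : ℝ) • y.1)) : ℝ) : ℂ)) *
        (f (y.1 - y.2) * g y.2 * Complex.exp (Complex.I * (phase r U (y.1 - y.2) y.2 : ℂ))) :=
    h1.measurable.mul (((hf.comp measurable_sub).mul (hg.comp measurable_snd)).mul
      continuous_exp_phase_sub.measurable)
  exact this.stronglyMeasurable.integral_prod_right.measurable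

/-- The L² norm in v of the shifted Gaussian does not depend on u. Cauchy–Schwarz therefore bounds
|D(u)|² by a constant times the convolution of |f|² and |g|², which is integrable by Tonelli. -/
theorem memLp_dampedConv (hr : 0 < r) {δ : ℝ} (hδ : 0 < δ) (hfm : Measurable f) (hf : MemLp f 2)
    (hgm : Measurable g) (hg : MemLp g 2) : MemLp (dampedConv r U δ f g) 2 := by
  refine ⟨(measurable_dampedConv hfm hgm δ).aestronglyMeasurable, ?_⟩
  set A : R2n n → ℂ := fun z => ((Real.exp (-δ * quad r z) : ℝ) : ℂ) with hA
  have hA2 : MemLp A 2 := memLp_exp_neg_quad hr hδ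
  have hbound : ∀ u, ‖dampedConv r U δ f g u‖ₑ ^ 2 ≤
      eLpNorm A 2 volume ^ 2 * ∫⁻ v, ‖f (u - v)‖ₑ ^ 2 * ‖g v‖ₑ ^ 2 := by
    intro u
    set b : R2n n → ℂ := fun v =>
      f (u - v) * g v * Complex.exp (Complex.I * (phase r U (u - v) v : ℂ)) with hb
    have hmp := measurePreserving_sub_right (volume : Measure (R2n n)) ((1 / 2 : ℝ) • u)
    have hbm : Measurable b :=
      ((hfm.comp (measurable_const_sub u)).mul hgm).mul
        ((continuous_exp_phase_sub (r := r) (U := U)).comp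
          (by fun_prop : Continuous fun v : R2n n => (u, v))).measurable
    have h1 : ‖dampedConv r U δ f g u‖ₑ ≤ eLpNorm A 2 volume * eLpNorm b 2 volume := by
      rw [← eLpNorm_comp_measurePreserving hA2.1 hmp]
      exact enorm_integral_mul_le (hA2.1.comp_measurePreserving hmp) hbm.aestronglyMeasurable
    calc ‖dampedConv r U δ f g u‖ₑ ^ 2
        ≤ (eLpNorm A 2 volume * eLpNorm b 2 volume) ^ 2 := by gcongr
      _ = eLpNorm A 2 volume ^ 2 * ∫⁻ v, ‖b v‖ₑ ^ 2 := by rw [mul_pow, eLpNorm_two_sq _ b]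
      _ = _ := by
        congr 2 with v
        have : ‖Complex.exp (Complex.I * (phase r U (u - v) v : ℂ))‖ₑ = 1 := by
          rw [← ofReal_norm, mul_comm Complex.I, Complex.norm_exp_ofReal_mul_I, ENNReal.ofReal_one]
        rw [hb, enorm_mul, enorm_mul, this, mul_one, mul_pow]
  have hmeas : Measurable (Function.uncurry fun u v : R2n n => ‖f (u - v)‖ₑ ^ 2 * ‖g v‖ₑ ^ 2) :=
    ((hfm.comp measurable_sub).enorm.pow_const 2).mul ((hgm.comp measurable_snd).enorm.pow_const 2)
  have hfin : eLpNorm (dampedConv r U δ f g) 2 volume ^ 2 < ⊤ := by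
    rw [eLpNorm_two_sq]
    refine (lintegral_mono hbound).trans_lt ?_
    rw [lintegral_const_mul' _ _ (ENNReal.pow_ne_top hA2.2.ne),
      lintegral_lintegral_swap hmeas.aemeasurable]
    have h3 : ∀ v, ∫⁻ u, ‖f (u - v)‖ₑ ^ 2 * ‖g v‖ₑ ^ 2 =
        eLpNorm f 2 volume ^ 2 * ‖g v‖ₑ ^ 2 := by
      intro v
      rw [lintegral_mul_const' _ _ (by simp), lintegral_sub_right_eq_self (fun u => ‖f u‖ₑ ^ 2) v,
        eLpNorm_two_sq]
    simp_rw [h3]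
    rw [lintegral_const_mul' _ _ (ENNReal.pow_ne_top hf.2.ne), ← eLpNorm_two_sq]
    exact ENNReal.mul_lt_top (ENNReal.pow_lt_top hA2.2)
      (ENNReal.mul_lt_top (ENNReal.pow_lt_top hf.2) (ENNReal.pow_lt_top hg.2))
  by_contra h
  rw [not_lt, top_le_iff] at h
  simp [h] at hfin

/-- Twisted convolution of Gaussian multiples of `L²` functions. -/
theorem twistedConv_gaussian (κ δ : ℝ) (f g : R2n n → ℂ) (u : R2n n) :
    twistedConv r U (fun ζ => ((κ * Real.exp (-δ * quad r ζ) : ℝ) : ℂ) * f ζ)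
      (fun ζ => ((κ * Real.exp (-δ * quad r ζ) : ℝ) : ℂ) * g ζ) u =
      ((κ ^ 2 * Real.exp (-(δ / 2) * quad r u) : ℝ) : ℂ) * dampedConv r U (2 * δ) f g u := by
  rw [twistedConv, dampedConv, ← integral_const_mul]
  congr 1 with v
  have h : Real.exp (-δ * quad r (u - v)) * Real.exp (-δ * quad r v) =
      Real.exp (-(δ / 2) * quad r u) * Real.exp (-(2 * δ) * quad r (v - (1 / 2 : ℝ) • u)) := by
    rw [← Real.exp_add, ← Real.exp_add]
    congr 1
    linear_combination (-δ) * quad_sub_add_quad (r := r) u v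
  have h' := congrArg Complex.ofReal h
  rw [Complex.ofReal_mul, Complex.ofReal_mul] at h'
  simp only [Complex.ofReal_mul, Complex.ofReal_pow]
  linear_combination ((κ : ℂ) ^ 2 * f (u - v) * g v *
    Complex.exp (Complex.I * (phase r U (u - v) v : ℂ))) * h'

end Gaussian

/-! ### Gaussian decay of the Fourier transform, and its inversion. -/

section ClassW

variable {n : ℕ} {r : ℝ}

theorem measurable_hat (u : Lp ℂ 2 (volume : Measure (R2n n))) : Measurable (hat u) :=
  (((Lp.stronglyMeasurable _).measurable).comp (measurable_const_smul _)).const_mul _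

/-- A function whose Fourier transform has Gaussian decay: the coefficient is a Gaussian times
an `L²` function. -/
theorem exists_coeff_eq {c : ℝ} {u : Lp ℂ 2 (volume : Measure (R2n n))} {f : R2n n → ℂ}
    (hf : MemLp f 2) (h : ∀ᵐ ζ, ‖hat u ζ‖ ≤ Real.exp (-c * quad r ζ) * ‖f ζ‖) :
    ∃ f₀ : R2n n → ℂ, Measurable f₀ ∧ MemLp f₀ 2 ∧ coeff r u = fun ζ =>
      ((((2 * Real.pi) ^ ((n : ℝ) / 2))⁻¹ * Real.exp (-(c + 1 / 4) * quad r ζ) : ℝ) : ℂ) *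
        f₀ ζ := by
  have hc := continuous_quad (n := n) (r := r)
  have hm : Continuous fun ζ : R2n n => ((Real.exp (c * quad r ζ) : ℝ) : ℂ) := by fun_prop
  have hme : Measurable fun ζ => ((Real.exp (c * quad r ζ) : ℝ) : ℂ) * hat u ζ :=
    hm.measurable.mul (measurable_hat u)
  -- The witness is `hat u` divided by the Gaussian, not the given f. It is measurable and makes the
  -- factorization hold everywhere; f serves only to dominate it.
  refine ⟨fun ζ => ((Real.exp (c * quad r ζ) : ℝ) : ℂ) * hat u ζ, hme,
    hf.mono hme.aestronglyMeasurable ?_, ?_⟩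
  · filter_upwards [h] with ζ hζ
    rw [norm_mul, Complex.norm_real, Real.norm_of_nonneg (Real.exp_pos _).le]
    refine (mul_le_mul_of_nonneg_left hζ (Real.exp_pos _).le).trans_eq ?_
    rw [← mul_assoc, ← Real.exp_add]
    simp
  · ext ζ
    rw [coeff, ← mul_assoc, ← Complex.ofReal_mul, mul_assoc _ (Real.exp _), ← Real.exp_add]
    congr 4
    ring_nf

theorem integrable_gaussian_mul (hr : 0 < r) (κ : ℝ) {δ : ℝ} (hδ : 0 < δ) {f : R2n n → ℂ}
    (hf : MemLp f 2) :
    Integrable fun ζ => ((κ * Real.exp (-δ * quad r ζ) : ℝ) : ℂ) * f ζ := by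
  refine (((memLp_exp_neg_quad hr hδ).integrable_mul hf).const_mul (κ : ℂ)).congr
    (Filter.Eventually.of_forall fun ζ => ?_)
  simp only [Pi.mul_apply]
  push_cast
  ring

/-- Every `L²` function is `hat u` for some `u`. -/
theorem exists_hat_eq {h : R2n n → ℂ} (hm : Measurable h) (h2 : MemLp h 2) :
    ∃ u : Lp ℂ 2 (volume : Measure (R2n n)), hat u =ᵐ[volume] h := by
  have hpi : (2 * Real.pi) ≠ 0 := by positivity
  -- D undoes the scaling and the constant in `hat`, so its inverse Fourier transform is the desired
  -- u.
  set D : R2n n → ℂ := fun w => (((2 * Real.pi) ^ n : ℝ) : ℂ) * h ((2 * Real.pi) • w) with hD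
  have hD2 : MemLp D 2 := by
    refine MemLp.const_mul ?_ _
    have hms : Measurable fun w => h ((2 * Real.pi) • w) := hm.comp (measurable_const_smul _)
    rw [memLp_two_iff_integrable_sq_norm hms.aestronglyMeasurable]
    exact ((memLp_two_iff_integrable_sq_norm h2.1).1 h2).comp_smul hpi
  refine ⟨𝓕⁻ (hD2.toLp D), ?_⟩
  filter_upwards [(Measure.quasiMeasurePreserving_smul (volume : Measure (R2n n))
    (inv_ne_zero hpi)).ae_eq hD2.coeFn_toLp] with ζ hζ
  simp only [Function.comp_apply] at hζ
  rw [hat, FourierTransform.fourier_fourierInv_eq, hζ, hD]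
  simp only [smul_inv_smul₀ hpi]
  rw [← mul_assoc, ← Complex.ofReal_mul, inv_mul_cancel₀ (by positivity)]
  simp

end ClassW

/-! ### Translation between `B_k` and the pair (‖k‖, U). -/

section Reduction

variable {n m : ℕ} {B : Fin m → Matrix (Fin n) (Fin n) ℝ} {k : EuclideanSpace ℝ (Fin m)}
  {U : Rn n ≃ₗᵢ[ℝ] Rn n}

theorem schrodinger_eq_weyl (hU : ∀ x, act (matB B k) x = ‖k‖ • U x) (z : R2n n) (u : Rn n → ℂ) :
    schrodinger B k z u = weyl ‖k‖ U z u := by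
  ext x
  rw [schrodinger, weyl, hU, inner_smul_right]

theorem twist_eq (hk : k ≠ 0) (hU : ∀ x, act (matB B k) x = ‖k‖ • U x)
    (hU' : ∀ x, act (matB B k).transpose x = ‖k‖ • U.symm x) (F : R2n n → ℂ) :
    twist B k F = fun z => F (‖k‖⁻¹ • rotation U z) := by
  have hk' : ‖k‖ ≠ 0 := norm_ne_zero_iff.2 hk
  have h : ‖k‖ * (‖k‖ ^ 2)⁻¹ = ‖k‖⁻¹ := by field_simp
  ext z
  rw [twist]
  congr 1
  apply R2n_ext
  · simp [hU, rotation_apply, smul_smul, h]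
  · simp [hU', rotation_apply, smul_smul, h]

theorem norm_act_sq (hU : ∀ x, act (matB B k) x = ‖k‖ • U x) (ζ : R2n n) :
    ‖act (matB B k) ζ.fst‖ ^ 2 + ‖ζ.snd‖ ^ 2 = quad ‖k‖ ζ := by
  rw [hU, norm_smul, norm_norm, LinearIsometryEquiv.norm_map, mul_pow, quad]

/-- An operator is the localization operator with symbol `F ∈ L²` if it is the superposition of
the `π(ζ)` with the corresponding coefficients. -/
theorem IsSuperposition.isLocalizationOperator (hk : k ≠ 0)
    (hU : ∀ x, act (matB B k) x = ‖k‖ • U x) {F : R2n n → ℂ} (hF2 : MemLp F 2)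
    (hF : MemLp (fun z => F (‖k‖⁻¹ • rotation U z)) 2)
    {T : Lp ℂ 2 (volume : Measure (Rn n)) →L[ℂ] Lp ℂ 2 (volume : Measure (Rn n))}
    {a : R2n n → ℂ} (hT : IsSuperposition ‖k‖ U a T)
    (ha : coeff ‖k‖ (hF.toLp _) =ᵐ[volume] a) :
    IsLocalizationOperator B k (gaussianWavelet n) F T := by
  intro f g
  have hr : 0 < ‖k‖ := norm_pos_iff.2 hk
  have hW : ∀ z, F z * pairing f (schrodinger B k z (gaussianWavelet n)) *
      pairing (schrodinger B k z (gaussianWavelet n)) g = F z * wavelet ‖k‖ U f g z := by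
    intro z
    rw [schrodinger_eq_weyl hU, wavelet, mul_assoc]
  simp_rw [hW]
  refine ⟨hF2.integrable_mul (memLp_wavelet hr (measurable_coe f) (Lp.memLp f)
    (measurable_coe g) (Lp.memLp g)), ?_⟩
  rw [integral_mul_wavelet hr hF (measurable_coe f) (Lp.memLp f) (measurable_coe g) (Lp.memLp g),
    hT f g]
  refine integral_congr_ae ?_
  filter_upwards [ha] with ζ hζ
  rw [hζ]

theorem ClassW.exists_coeff {c : ℝ} {F : R2n n → ℂ} (hk : k ≠ 0)
    (hU : ∀ x, act (matB B k) x = ‖k‖ • U x)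
    (hU' : ∀ x, act (matB B k).transpose x = ‖k‖ • U.symm x) (hF : ClassW B k c F) :
    ∃ hF' : MemLp (fun z => F (‖k‖⁻¹ • rotation U z)) 2, ∃ f₀ : R2n n → ℂ,
      Measurable f₀ ∧ MemLp f₀ 2 ∧ coeff ‖k‖ (hF'.toLp _) = fun ζ =>
        ((((2 * Real.pi) ^ ((n : ℝ) / 2))⁻¹ * Real.exp (-(c + 1 / 4) * quad ‖k‖ ζ) : ℝ) : ℂ) *
          f₀ ζ := by
  obtain ⟨-, hF', f, hf, hb⟩ := hF
  simp only [norm_act_sq hU] at hb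
  have h := exists_coeff_eq hf hb
  have ht := twist_eq hk hU hU' F
  -- The L² class depends on a membership proof for the twisted function, so the function is
  -- generalized and substituted rather than rewritten.
  generalize twist B k F = Fk at *
  subst ht
  exact ⟨hF', h⟩

theorem memLp_comp_smul_rotation_symm {r : ℝ} (hr : r ≠ 0)
    (u : Lp ℂ 2 (volume : Measure (R2n n))) :
    MemLp (fun z => u (r • (rotation U).symm z)) 2 := by
  have hm : Measurable u := (Lp.stronglyMeasurable u).measurable
  have hm' : Measurable fun z => u (r • (rotation U).symm z) :=
    hm.comp ((rotation U).symm.continuous.const_smul r).measurable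
  rw [memLp_two_iff_integrable_sq_norm hm'.aestronglyMeasurable]
  exact (rotation U).symm.measurePreserving.integrable_comp_of_integrable
    (g := fun z => ‖u (r • z)‖ ^ 2)
    (((memLp_two_iff_integrable_sq_norm hm.aestronglyMeasurable).1 (Lp.memLp u)).comp_smul hr)

/-- The symbol class, in terms of the Fourier transform of the twisted symbol. -/
theorem classW_of_hat_eq {d : ℝ} (hk : k ≠ 0)
    (hU : ∀ x, act (matB B k) x = ‖k‖ • U x)
    (hU' : ∀ x, act (matB B k).transpose x = ‖k‖ • U.symm x)
    {u : Lp ℂ 2 (volume : Measure (R2n n))} {f : R2n n → ℂ} (hf : MemLp f 2)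
    (hu : ∀ᵐ ζ, ‖hat u ζ‖ ≤ Real.exp (-d * quad ‖k‖ ζ) * ‖f ζ‖) :
    ClassW B k d fun z => u (‖k‖ • (rotation U).symm z) := by
  have hk' : ‖k‖ ≠ 0 := norm_ne_zero_iff.2 hk
  have ht : twist B k (fun z => u (‖k‖ • (rotation U).symm z)) = u := by
    rw [twist_eq hk hU hU']
    ext z
    rw [map_smul, smul_inv_smul₀ hk', LinearIsometryEquiv.symm_apply_apply]
  refine ⟨memLp_comp_smul_rotation_symm hk' u, by rw [ht]; exact Lp.memLp u, f, hf, ?_⟩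
  simp only [norm_act_sq hU, ht, Lp.toLp_coeFn]
  exact hu

end Reduction

end HeisLoc

end

/-! ### The product theorem. -/

open HeisLoc in
/-- The product theorem with the sharper decay rate `c / 2 - 1 / 8`, for all `c > 1 / 4`. -/
theorem HeisLoc.exists_product_symbol {n m : ℕ} {B : Fin m → Matrix (Fin n) (Fin n) ℝ}
    (hB : IsStructureFamily B) {k : EuclideanSpace ℝ (Fin m)} (hk : k ≠ 0)
    {c : ℝ} (hc : 1 / 4 < c) {F G : R2n n → ℂ}
    (hF : ClassW B k c F) (hG : ClassW B k c G) :
    ∃ LF LG : Lp ℂ 2 (volume : Measure (Rn n)) →L[ℂ] Lp ℂ 2 (volume : Measure (Rn n)),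
      IsLocalizationOperator B k (gaussianWavelet n) F LF ∧
      IsLocalizationOperator B k (gaussianWavelet n) G LG ∧
      ∃ H : R2n n → ℂ,
        IsLocalizationOperator B k (gaussianWavelet n) H (LF.comp LG) ∧
        ∀ d ≤ c / 2 - 1 / 8, ClassW B k d H := by
  obtain ⟨U, hU, hU'⟩ := hB.exists_isometry hk
  have hr : 0 < ‖k‖ := norm_pos_iff.2 hk
  have hc' : 0 < c + 1 / 4 := by linarith
  obtain ⟨hF', f, hfm, hf, hcF⟩ := hF.exists_coeff hk hU hU'
  obtain ⟨hG', g, hgm, hg, hcG⟩ := hG.exists_coeff hk hU hU'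
  set κ : ℝ := ((2 * Real.pi) ^ ((n : ℝ) / 2))⁻¹ with hκ
  have hiF := integrable_gaussian_mul hr κ hc' hf
  have hiG := integrable_gaussian_mul hr κ hc' hg
  obtain ⟨LF, hLF⟩ := exists_isSuperposition (r := ‖k‖) (U := U) hiF
  obtain ⟨LG, hLG⟩ := exists_isSuperposition (r := ‖k‖) (U := U) hiG
  refine ⟨LF, LG, hLF.isLocalizationOperator hk hU hF.1 hF' hcF.eventuallyEq,
    hLG.isLocalizationOperator hk hU hG.1 hG' hcG.eventuallyEq, ?_⟩
  set D := dampedConv ‖k‖ U (2 * (c + 1 / 4)) f g with hD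
  have hDm : Measurable D := measurable_dampedConv hfm hgm _
  have hD2 : MemLp D 2 := memLp_dampedConv hr (by linarith) hfm hf hgm hg
  -- The required transform of H^k: the twisted convolution has the factor κ² exp(-(c + 1/4)Q/2),
  -- and `coeff` accounts for κ exp(-Q/4) of it.
  set h : R2n n → ℂ := fun ζ =>
    ((κ * Real.exp (-(c / 2 - 1 / 8) * quad ‖k‖ ζ) : ℝ) : ℂ) * D ζ with hh
  have hcq := continuous_quad (n := n) (r := ‖k‖)
  have hm : Measurable h := by
    refine Measurable.mul (Continuous.measurable ?_) hDm
    fun_prop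
  have hκD : MemLp (fun ζ => (κ : ℂ) * D ζ) 2 := hD2.const_mul _
  have hnorm : ∀ d ≤ c / 2 - 1 / 8, ∀ ζ,
      ‖h ζ‖ ≤ Real.exp (-d * quad ‖k‖ ζ) * ‖(κ : ℂ) * D ζ‖ := by
    intro d hd ζ
    simp only [hh, Complex.ofReal_mul]
    rw [mul_right_comm, mul_comm, norm_mul, Complex.norm_real,
      Real.norm_of_nonneg (Real.exp_pos _).le]
    have := quad_nonneg (r := ‖k‖) ζ
    gcongr
  have h2 : MemLp h 2 := by
    refine hκD.mono hm.aestronglyMeasurable (Filter.Eventually.of_forall fun ζ => ?_)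
    -- Rate d = 0 is admissible because c > 1/4; this is what makes h square integrable.
    simpa using hnorm 0 (by linarith) ζ
  obtain ⟨u, hu⟩ := exists_hat_eq hm h2
  have hu' : (fun z => (fun z => u (‖k‖ • (rotation U).symm z)) (‖k‖⁻¹ • rotation U z)) = u := by
    ext z
    simp only [map_smul, smul_inv_smul₀ hr.ne', LinearIsometryEquiv.symm_apply_apply]
  have hH : ∀ d ≤ c / 2 - 1 / 8, ClassW B k d fun z => u (‖k‖ • (rotation U).symm z) := by
    intro d hd
    refine classW_of_hat_eq hk hU hU' hκD ?_
    filter_upwards [hu] with ζ hζ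
    rw [hζ]
    exact hnorm d hd ζ
  refine ⟨_, (hLF.comp hiF hiG hLG).isLocalizationOperator hk hU (hH _ le_rfl).1
    (by rw [hu']; exact Lp.memLp u) ?_, hH⟩
  simp only [hu', Lp.toLp_coeFn]
  filter_upwards [hu] with ζ hζ
  rw [coeff, hζ, twistedConv_gaussian, hh, ← mul_assoc, ← Complex.ofReal_mul]
  congr 2
  have : Real.exp (-((c + 1 / 4) / 2) * quad ‖k‖ ζ) =
      Real.exp (-quad ‖k‖ ζ / 4) * Real.exp (-(c / 2 - 1 / 8) * quad ‖k‖ ζ) := by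
    rw [← Real.exp_add]
    congr 1
    ring
  rw [this, ← hκ]
  ring

theorem mainTheorem6 (n m : ℕ) (B : Fin m → Matrix (Fin n) (Fin n) ℝ)
    (hB : HeisLoc.IsStructureFamily B) (k : EuclideanSpace ℝ (Fin m)) (hk : k ≠ 0)
    (c : ℝ) (hc : (1 + Real.sqrt 5) / 8 < c) (F G : HeisLoc.R2n n → ℂ)
    (hF : HeisLoc.ClassW B k c F) (hG : HeisLoc.ClassW B k c G) :
    ∃ LF LG : Lp ℂ 2 (volume : Measure (HeisLoc.Rn n)) →L[ℂ]
        Lp ℂ 2 (volume : Measure (HeisLoc.Rn n)),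
      HeisLoc.IsLocalizationOperator B k (HeisLoc.gaussianWavelet n) F LF ∧
      HeisLoc.IsLocalizationOperator B k (HeisLoc.gaussianWavelet n) G LG ∧
      ∃ H : HeisLoc.R2n n → ℂ,
        HeisLoc.IsLocalizationOperator B k (HeisLoc.gaussianWavelet n) H (LF.comp LG) ∧
        ∀ ε : ℝ, 4 * c / (8 * c + 1) < ε → ε < 1 - 1 / (4 * c) →
          ∀ d : ℝ, 0 < d → d ≤ c - c * ε - 1 / 4 → HeisLoc.ClassW B k d H := by
  -- The threshold (1 + √5)/8 is the positive root of 16c² - 4c - 1, above which the interval of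
  -- admissible ε is nonempty. It exceeds 1/4.
  have h5 : 1 ≤ Real.sqrt 5 := Real.one_le_sqrt.2 (by norm_num)
  have hc4 : 1 / 4 < c := by linarith
  obtain ⟨LF, LG, hLF, hLG, H, hH, hW⟩ := HeisLoc.exists_product_symbol hB hk hc4 hF hG
  refine ⟨LF, LG, hLF, hLG, H, hH, fun ε hε _ d _ hd => hW d (hd.trans ?_)⟩
  -- What is needed is c/2 - 1/8 ≤ cε. It holds because (c/2 - 1/8)(8c + 1) = 4c² - c/2 - 1/8 < 4c²
  -- < cε(8c + 1).
  rw [div_lt_iff₀ (by linarith)] at hε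
  nlinarith
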